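/- Let $n\ge 1$ and let $F(Z^1,\dots,Z^n)$ be a complex homogeneous quadratic polynomial such that the real symmetric matrix $N_{AB}=\operatorname{Im}F_{AB}$, $F_{AB}=\partial^2F/\partial Z^A\partial Z^B$, has signature $(1,n-1)$; let $(N^{AB})$ be its inverse. Let $M_{\rm sk}\subset\mathbb{CP}^{n-1}$ be the open set of lines $[Z]$ with $\sum Z^AN_{AB}\bar Z^B>0$, with its Kähler metric of potential $K=-\ln(2\sum Z^AN_{AB}\bar Z^B)$ (evaluated on local holomorphic sections $Z$). Let $G=\mathbb R^{2n+2}$ with coordinates $(\phi,\tilde\phi,a^A,b_A)_{A=1,\dots,n}$, let $M=M_{\rm sk}\times G$, and let $\pi:M\to M_{\rm sk}$ be the projection. Let $e^b=\sum_A\Pi_A^{\,b}\,dZ^A$ $(b=1,\dots,n-1)$ be a local unitary coframe of type $(1,0)$ on $M_{\rm sk}$, with $\sum_A \Pi_A^{\,b}Z^A=0$, and put (summing over repeated indices) $$u=i e^{K/2+\phi}Z^A(db_A-F_{AB}\,da^B),\qquad v=\tfrac12 e^{2\phi}\bigl[d e^{-2\phi}+i(d\tilde\phi+b_A\,da^A-a^A\,db_A)\bigr],$$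 $$E^b=-\tfrac i2 e^{\phi-K/2}\,\Pi_A^{\,b}N^{AB}(db_B-\bar F_{BC}\,da^C).$$ Let $J_3$ be the almost complex structure on $M$ for which $u,\bar v,e^b,\bar E^b$ form a basis of the $(1,0)$-forms (it does not depend on the choice of the local section $Z$ and of the coframe). Let $H^{n-1}_{\mathbb C}$ be complex hyperbolic space, i.e. the unit ball in $\mathbb C^{n-1}$ with the Kähler metric of potential $-\ln(1-|z|^2)$, and let $$F(n+1)=\Bigl\{(w^0,w_1,\dots,w_n)\in\mathbb C^{n+1}\ \Big|\ \operatorname{Re}w^0>\sum_{A=1}^{n-1}(\operatorname{Im}w_A)^2-(\operatorname{Im}w_n)^2\Bigr\}.$$ Then: 1. $\pi:(M,J_3)\to M_{\rm sk}$ is a holomorphic submersion, and $M_{\rm sk}$ is biholomorphically isometric to $H^{n-1}_{\mathbb C}$. 2. $\pi$ is a trivial holomorphic fibre bundle with fibre $F(n+1)$: there is a biholomorphism $(M,J_3)\to M_{\rm sk}\times F(n+1)$ commuting with the projections to $M_{\rm sk}$. 3. $(M,J_3)$ is biholomorphic to $H^{n-1}_{\mathbb C}\times F(n+1)$. -/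

import Mathlib

open scoped Manifold ContDiff Matrix LinearAlgebra.Projectivization ComplexConjugate

/-! ## Complex projective space as a complex manifold -/

/-- Complex projective space `ℂP^m`, the set of complex lines in `ℂ^(m+1)`. -/
def CP (m : ℕ) : Type := ℙ ℂ (Fin (m + 1) → ℂ)

namespace CP

variable {m : ℕ}

/-- The line `[Z]` spanned by a nonzero vector `Z`. -/
noncomputable def mk (Z : {Z : Fin (m + 1) → ℂ // Z ≠ 0}) : CP m := Projectivization.mk' ℂ Z

/-- A chosen nonzero vector on the line. -/
noncomputable def rep (p : CP m) : Fin (m + 1) → ℂ := Projectivization.rep p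

/-- The quotient topology. -/
noncomputable instance : TopologicalSpace (CP m) := TopologicalSpace.coinduced mk inferInstance

theorem isQuotientMap_mk : Topology.IsQuotientMap (mk (m := m)) where
  surjective := by
    intro p
    induction p using Projectivization.ind with
    | h v hv => exact ⟨⟨v, hv⟩, rfl⟩
  eq_coinduced := rfl

theorem rep_ne_zero (p : CP m) : p.rep ≠ 0 := Projectivization.rep_nonzero p

theorem mk_rep (p : CP m) : mk ⟨p.rep, p.rep_ne_zero⟩ = p := Projectivization.mk_rep p

theorem exists_rep_mk (Z : {Z : Fin (m + 1) → ℂ // Z ≠ 0}) :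
    ∃ c : ℂ, c ≠ 0 ∧ (mk Z).rep = c • (Z : Fin (m + 1) → ℂ) := by
  obtain ⟨a, ha⟩ := Projectivization.exists_smul_eq_mk_rep ℂ (Z : Fin (m + 1) → ℂ) Z.2
  exact ⟨a, a.ne_zero, ha.symm⟩

theorem mk_eq_mk {Z W : {Z : Fin (m + 1) → ℂ // Z ≠ 0}} (c : ℂ)
    (h : c • (W : Fin (m + 1) → ℂ) = Z) : mk Z = mk W :=
  (Projectivization.mk_eq_mk_iff' ℂ _ _ Z.2 W.2).2 ⟨c, h⟩

/-- The affine coordinates `z^a = Z^a / Z^i`, `a ≠ i`. -/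
noncomputable def coord (i : Fin (m + 1)) (p : CP m) : Fin m → ℂ :=
  fun a => p.rep (i.succAbove a) / p.rep i

/-- The vector with `i`-th entry `1` and remaining entries `z`. -/
def affVec (i : Fin (m + 1)) (z : Fin m → ℂ) : Fin (m + 1) → ℂ := i.insertNth 1 z

theorem affVec_ne_zero (i : Fin (m + 1)) (z : Fin m → ℂ) : affVec i z ≠ 0 := fun h => by
  have := congrFun h i
  simp [affVec] at this

theorem rep_mk_ne_zero_iff (i : Fin (m + 1)) (Z : {Z : Fin (m + 1) → ℂ // Z ≠ 0}) :
    (mk Z).rep i ≠ 0 ↔ (Z : Fin (m + 1) → ℂ) i ≠ 0 := by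
  obtain ⟨c, hc, h⟩ := exists_rep_mk Z
  simp [h, hc]

theorem coord_mk (i : Fin (m + 1)) (Z : {Z : Fin (m + 1) → ℂ // Z ≠ 0}) :
    coord i (mk Z) = fun a => (Z : Fin (m + 1) → ℂ) (i.succAbove a) / (Z : Fin (m + 1) → ℂ) i := by
  obtain ⟨c, hc, h⟩ := exists_rep_mk Z
  funext a
  simp only [coord, h, Pi.smul_apply, smul_eq_mul]
  exact mul_div_mul_left _ _ hc

theorem continuous_entry (j : Fin (m + 1)) :
    Continuous fun Z : {Z : Fin (m + 1) → ℂ // Z ≠ 0} => (Z : Fin (m + 1) → ℂ) j :=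
  (continuous_apply j).comp continuous_subtype_val

theorem isOpen_source (i : Fin (m + 1)) : IsOpen {p : CP m | p.rep i ≠ 0} := by
  rw [← isQuotientMap_mk.isOpen_preimage]
  have : mk ⁻¹' {p : CP m | p.rep i ≠ 0} =
      {Z : {Z : Fin (m + 1) → ℂ // Z ≠ 0} | (Z : Fin (m + 1) → ℂ) i ≠ 0} := by
    ext Z; exact rep_mk_ne_zero_iff i Z
  rw [this]
  exact isOpen_ne_fun (continuous_entry i) continuous_const

/-- The affine chart `[Z] ↦ (Z^a / Z^i)_{a ≠ i}` on `{Z^i ≠ 0}`. -/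
noncomputable def chart (i : Fin (m + 1)) : OpenPartialHomeomorph (CP m) (Fin m → ℂ) where
  toFun := coord i
  invFun z := mk ⟨affVec i z, affVec_ne_zero i z⟩
  source := {p | p.rep i ≠ 0}
  target := Set.univ
  map_source' _ _ := Set.mem_univ _
  map_target' z _ := (rep_mk_ne_zero_iff i _).2 (by simp [affVec])
  left_inv' p hp := by
    refine (mk_eq_mk (p.rep i)⁻¹ ?_).trans p.mk_rep
    refine Fin.eq_insertNth_iff.2 ⟨by simpa using inv_mul_cancel₀ hp, ?_⟩
    funext a
    simp [Fin.removeNth, coord, div_eq_inv_mul]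
  right_inv' z _ := by
    rw [coord_mk]; funext a; simp [affVec]
  continuousOn_toFun := by
    rw [isQuotientMap_mk.continuousOn_isOpen_iff (isOpen_source i)]
    have : ContinuousOn (fun Z : {Z : Fin (m + 1) → ℂ // Z ≠ 0} => fun a =>
        (Z : Fin (m + 1) → ℂ) (i.succAbove a) / (Z : Fin (m + 1) → ℂ) i)
        (mk ⁻¹' {p : CP m | p.rep i ≠ 0}) := by
      refine continuousOn_pi.2 fun a => ContinuousOn.div
        (continuous_entry _).continuousOn (continuous_entry i).continuousOn ?_
      intro Z hZ
      exact (rep_mk_ne_zero_iff i Z).1 hZ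
    exact this.congr fun Z _ => coord_mk i Z
  continuousOn_invFun := by
    have h : Continuous fun z : Fin m → ℂ =>
        (⟨affVec i z, affVec_ne_zero i z⟩ : {Z : Fin (m + 1) → ℂ // Z ≠ 0}) := by
      refine Continuous.subtype_mk ?_ _
      unfold affVec
      fun_prop
    exact (isQuotientMap_mk.continuous.comp h).continuousOn
  open_source := isOpen_source i
  open_target := isOpen_univ

theorem exists_rep_apply_ne_zero (p : CP m) : ∃ i, p.rep i ≠ 0 :=
  Function.ne_iff.1 p.rep_ne_zero

/-- The index `i` of the preferred affine chart around `p`. -/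
noncomputable def idx (p : CP m) : Fin (m + 1) := p.exists_rep_apply_ne_zero.choose

theorem rep_idx_ne_zero (p : CP m) : p.rep p.idx ≠ 0 := p.exists_rep_apply_ne_zero.choose_spec

noncomputable instance : ChartedSpace (Fin m → ℂ) (CP m) where
  atlas := Set.range chart
  chartAt p := chart p.idx
  mem_chart_source p := p.rep_idx_ne_zero
  chart_mem_atlas p := ⟨p.idx, rfl⟩

theorem transition_contDiffOn (𝕜 : Type) [NontriviallyNormedField 𝕜] [NormedAlgebra 𝕜 ℂ]
    (i j : Fin (m + 1)) :
    ContDiffOn 𝕜 ω (fun z : Fin m → ℂ => coord j (mk ⟨affVec i z, affVec_ne_zero i z⟩))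
      {z | affVec i z j ≠ 0} := by
  have hA : ∀ k : Fin (m + 1), ContDiff 𝕜 ω fun z : Fin m → ℂ => affVec i z k := by
    intro k
    induction k using i.succAboveCases with
    | x => simpa [affVec] using contDiff_const
    | p a => simpa [affVec] using contDiff_apply 𝕜 ℂ a
  simp only [coord_mk]
  refine contDiffOn_pi.2 fun a => ?_
  simp only [div_eq_mul_inv]
  exact (hA _).contDiffOn.mul ((hA j).contDiffOn.inv fun z hz => hz)

theorem isManifold_aux (𝕜 : Type) [NontriviallyNormedField 𝕜] [NormedAlgebra 𝕜 ℂ] :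
    IsManifold 𝓘(𝕜, Fin m → ℂ) ω (CP m) := by
  refine isManifold_of_contDiffOn _ _ _ ?_
  rintro _ _ ⟨i, rfl⟩ ⟨j, rfl⟩
  refine (transition_contDiffOn 𝕜 i j).mono ?_
  intro z hz
  exact (rep_mk_ne_zero_iff j _).1 hz.1.2

/-- `ℂP^m` is a complex manifold. -/
instance : IsManifold 𝓘(ℂ, Fin m → ℂ) ω (CP m) := isManifold_aux ℂ

/-- `ℂP^m` is a real analytic manifold. -/
instance : IsManifold 𝓘(ℝ, Fin m → ℂ) ω (CP m) := isManifold_aux ℝ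

end CP

/-! ## Almost complex structures and biholomorphisms -/

section AlmostComplex

variable {E H E' H' : Type*} [NormedAddCommGroup E] [NormedSpace ℝ E] [TopologicalSpace H]
  [NormedAddCommGroup E'] [NormedSpace ℝ E'] [TopologicalSpace H']

/-- Fields of endomorphisms of the tangent spaces of a manifold. -/
abbrev TangentEndField (I : ModelWithCorners ℝ E H) (X : Type*) [TopologicalSpace X]
    [ChartedSpace H X] : Type _ :=
  ∀ x : X, TangentSpace I x →ₗ[ℝ] TangentSpace I x

/-- The complex structure of a complex manifold `X` whose charts take values in the complex vector
space `E`: multiplication by `i` on each tangent space. -/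
noncomputable def mulI [Module ℂ E] [SMulCommClass ℂ ℝ E] (I : ModelWithCorners ℝ E H) (X : Type*)
    [TopologicalSpace X] [ChartedSpace H X] : TangentEndField I X :=
  fun _ => (DistribSMul.toLinearMap ℝ E Complex.I : E →ₗ[ℝ] E)

/-- A map is holomorphic for (almost) complex structures `J`, `J'` if it is smooth and its
differential intertwines them. -/
def IsHolomorphicMap (I : ModelWithCorners ℝ E H) (I' : ModelWithCorners ℝ E' H')
    {X Y : Type*} [TopologicalSpace X] [ChartedSpace H X] [TopologicalSpace Y] [ChartedSpace H' Y]
    (J : TangentEndField I X) (J' : TangentEndField I' Y) (f : X → Y) : Prop :=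
  ContMDiff I I' ∞ f ∧
    ∀ (x : X) (v : TangentSpace I x), mfderiv I I' f x (J x v) = J' (f x) (mfderiv I I' f x v)

end AlmostComplex

/-! ## Quadratic prepotentials -/

/-- The matrix of second derivatives `F_AB` of a quadratic form `F` (these are constants). -/
noncomputable def hessMatrix {n : ℕ} (F : MvPolynomial (Fin n) ℂ) : Matrix (Fin n) (Fin n) ℂ :=
  fun A B => MvPolynomial.constantCoeff (MvPolynomial.pderiv A (MvPolynomial.pderiv B F))

/-- The real matrix `N_AB = Im F_AB`. -/
noncomputable def imHess {n : ℕ} (F : MvPolynomial (Fin n) ℂ) : Matrix (Fin n) (Fin n) ℝ :=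
  fun A B => (hessMatrix F A B).im

theorem pderiv_pderiv_eq_C_hessMatrix {n : ℕ} {F : MvPolynomial (Fin n) ℂ}
    (hF : F.IsHomogeneous 2) (A B : Fin n) :
    MvPolynomial.pderiv A (MvPolynomial.pderiv B F) = MvPolynomial.C (hessMatrix F A B) := by
  have h : (MvPolynomial.pderiv A (MvPolynomial.pderiv B F)).IsHomogeneous 0 :=
    (hF.pderiv (i := B)).pderiv (i := A)
  exact MvPolynomial.totalDegree_eq_zero_iff_eq_C.1 (Nat.le_zero.1 h.totalDegree_le)

theorem hessMatrix_symm {n : ℕ} (F : MvPolynomial (Fin n) ℂ) :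
    (hessMatrix F).transpose = hessMatrix F := by
  ext A B
  simp only [Matrix.transpose_apply, hessMatrix]
  rw [show MvPolynomial.pderiv B (MvPolynomial.pderiv A F)
    = MvPolynomial.pderiv A (MvPolynomial.pderiv B F) from ?_]
  have h : ⁅(MvPolynomial.pderiv B : Derivation ℂ (MvPolynomial (Fin n) ℂ) (MvPolynomial (Fin n) ℂ)),
      (MvPolynomial.pderiv A : Derivation ℂ (MvPolynomial (Fin n) ℂ) (MvPolynomial (Fin n) ℂ))⁆ = 0 := by
    apply MvPolynomial.derivation_ext
    intro k
    classical
    simp only [Derivation.commutator_apply, MvPolynomial.pderiv_X, Pi.single_apply]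
    split_ifs <;> simp
  have := congrArg (fun D => D F) h
  simpa [Derivation.commutator_apply, sub_eq_zero] using this

/-- A quadratic prepotential in the variables `Z^1, …, Z^n`, `n = m + 1`: a complex quadratic form
`F` such that `N_AB = Im F_AB` has signature `(1, n - 1)`. -/
structure QuadraticPrepotential (m : ℕ) where
  poly : MvPolynomial (Fin (m + 1)) ℂ
  isHomogeneous : poly.IsHomogeneous 2
  sigPos_eq : sigPos (imHess poly).toQuadraticForm' = 1
  sigNeg_eq : sigNeg (imHess poly).toQuadraticForm' = m

/-- The coordinate space of the solvable group `G`, with coordinates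
`(φ, φ̃, (a^A), (b_A))`, `A = 1, …, m + 1`. -/
abbrev GCoord (m : ℕ) : Type := ℝ × ℝ × (Fin (m + 1) → ℝ) × (Fin (m + 1) → ℝ)

namespace QuadraticPrepotential

variable {m : ℕ} (F : QuadraticPrepotential m)

/-- `F_AB`. -/
noncomputable abbrev tau : Matrix (Fin (m + 1)) (Fin (m + 1)) ℂ := hessMatrix F.poly

/-- `N_AB = Im F_AB`. -/
noncomputable abbrev N : Matrix (Fin (m + 1)) (Fin (m + 1)) ℝ := imHess F.poly

/-- `N_AB` as a complex matrix. -/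
noncomputable abbrev NC : Matrix (Fin (m + 1)) (Fin (m + 1)) ℂ := F.N.map (fun x : ℝ => (x : ℂ))

/-- The inverse matrix `N^AB`, as a complex matrix. -/
noncomputable abbrev NinvC : Matrix (Fin (m + 1)) (Fin (m + 1)) ℂ :=
  (F.N⁻¹).map (fun x : ℝ => (x : ℂ))

/-- The Hermitian form `∑ Z^A N_AB conj(W^B)`. -/
noncomputable def herm (Z W : Fin (m + 1) → ℂ) : ℂ := Z ⬝ᵥ F.NC *ᵥ star W

theorem herm_smul_smul (c : ℂ) (Z : Fin (m + 1) → ℂ) :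
    F.herm (c • Z) (c • Z) = (Complex.normSq c : ℂ) * F.herm Z Z := by
  simp only [herm, star_smul, Matrix.mulVec_smul, smul_dotProduct, dotProduct_smul, smul_eq_mul]
  rw [← mul_assoc, Complex.star_def, mul_comm _ c, Complex.mul_conj]

theorem herm_smul_re_pos_iff {c : ℂ} (hc : c ≠ 0) (Z : Fin (m + 1) → ℂ) :
    0 < (F.herm (c • Z) (c • Z)).re ↔ 0 < (F.herm Z Z).re := by
  rw [herm_smul_smul, Complex.re_ofReal_mul]
  exact mul_pos_iff_of_pos_left (Complex.normSq_pos.2 hc)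

theorem continuous_herm : Continuous fun Z : Fin (m + 1) → ℂ => (F.herm Z Z).re := by
  unfold herm
  simp only [dotProduct, Matrix.mulVec]
  fun_prop

/-- The projective special Kähler domain `M_sk`: the set of complex lines `[Z]` in `ℂ^n` with
`∑ Z^A N_AB conj(Z^B) > 0`, an open subset of `ℂP^(n-1)`. -/
noncomputable def Msk : TopologicalSpace.Opens (CP m) where
  carrier := {p | 0 < (F.herm p.rep p.rep).re}
  is_open' := by
    rw [← CP.isQuotientMap_mk.isOpen_preimage]
    have : CP.mk ⁻¹' {p : CP m | 0 < (F.herm p.rep p.rep).re} =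
        {Z : {Z : Fin (m + 1) → ℂ // Z ≠ 0} |
          0 < (F.herm (Z : Fin (m + 1) → ℂ) (Z : Fin (m + 1) → ℂ)).re} := by
      ext Z
      obtain ⟨c, hc, h⟩ := CP.exists_rep_mk Z
      simp only [Set.mem_preimage, Set.mem_ofPred_eq, h]
      exact F.herm_smul_re_pos_iff hc _
    rw [this]
    exact isOpen_lt continuous_const (F.continuous_herm.comp continuous_subtype_val)

/-- The manifold `M = M_sk × G`. -/
abbrev M : Type := F.Msk × GCoord m

/-- Homogeneous coordinates `(Z^A)` of `p ∈ M_sk`, normalised so that `Z^i = 1`, where `i` is the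
index of the preferred affine chart of `ℂP^(n-1)` at `p`. -/
noncomputable def Z (p : F.Msk) : Fin (m + 1) → ℂ :=
  CP.affVec p.1.idx (CP.coord p.1.idx p.1)

/-- The differentials `(dZ^A)` of these homogeneous coordinates, applied to a tangent vector
`ζ = (dz^a)` of `M_sk`, given in the preferred affine chart. -/
noncomputable def dZ (p : F.Msk) (ζ : Fin m → ℂ) : Fin (m + 1) → ℂ :=
  p.1.idx.insertNth 0 ζ

/-- The Kähler potential `K = -log (2 ∑ Z^A N_AB conj(Z^B))`. -/
noncomputable def K (p : F.Msk) : ℝ := -Real.log (2 * (F.herm (F.Z p) (F.Z p)).re)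

/-- The Kähler metric `∑ (∂²K / ∂z^a ∂z̄^b) dz^a dz̄^b` of `M_sk`, evaluated on `(ζ, ζ)`. -/
noncomputable def skMetric (p : F.Msk) (ζ : TangentSpace 𝓘(ℝ, Fin m → ℂ) p) : ℝ :=
  -(F.herm (F.dZ p ζ) (F.dZ p ζ)).re / (F.herm (F.Z p) (F.Z p)).re
    + Complex.normSq (F.herm (F.dZ p ζ) (F.Z p)) / (F.herm (F.Z p) (F.Z p)).re ^ 2

/-! ### The one-forms of the quaternionic vielbein

Tangent vectors of `M = M_sk × G` at `p` are written `X = (ζ, dφ, dφ̃, da, db)`. A rescaling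
of the homogeneous coordinates `Z` multiplies `u` and `E` by phases; it does not change the
type decomposition defined by these forms. -/

/-- The complex-valued one-forms `db_A - ∑ F_AB da^B`. -/
noncomputable def dbFda (X : (Fin m → ℂ) × GCoord m) : Fin (m + 1) → ℂ :=
  (fun A => (X.2.2.2.2 A : ℂ)) - F.tau *ᵥ fun B => (X.2.2.2.1 B : ℂ)

/-- `u = i e^(K/2 + φ) ∑ Z^A (db_A - F_AB da^B)`. -/
noncomputable def uForm (p : F.M) (X : (Fin m → ℂ) × GCoord m) : ℂ :=
  Complex.I * (Real.exp (F.K p.1 / 2 + p.2.1) : ℂ) * (F.Z p.1 ⬝ᵥ F.dbFda X)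

/-- `v = ½ e^(2φ) [d e^(-2φ) + i (dφ̃ + ∑ (b_A da^A - a^A db_A))]`. With `u`, `e`, `E` as here, this
sign of `i` is the one for which `dv̄ = -v ∧ v̄ + ū ∧ u - ∑ E^b ∧ Ē^b`, one of the structure equations
of the quaternionic Kähler structure; the metric does not depend on the sign. -/
noncomputable def vForm (p : F.M) (X : (Fin m → ℂ) × GCoord m) : ℂ :=
  (1 / 2 : ℂ) * (Real.exp (2 * p.2.1) : ℂ) *
    (((-2 * Real.exp (-2 * p.2.1) * X.2.1 : ℝ) : ℂ) +
      Complex.I * ((X.2.2.1 + p.2.2.2.2 ⬝ᵥ X.2.2.2.1 - p.2.2.2.1 ⬝ᵥ X.2.2.2.2 : ℝ) : ℂ))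

/-- The matrix `Π_A^b`, for a coframe `e^b = ∑ e^b_a dz^a` of type `(1,0)` on `M_sk` with
coefficients `e^b_a = e a b` in the preferred affine chart: `Π_a^b = e^b_a` for `a ≠ i` and
`Π_i^b = - ∑ z^a e^b_a`. -/
noncomputable def PiMat (p : F.Msk) (e : Matrix (Fin m) (Fin m) ℂ) :
    Matrix (Fin (m + 1)) (Fin m) ℂ :=
  Matrix.of fun A b =>
    p.1.idx.insertNth (α := fun _ => ℂ) (-∑ a, CP.coord p.1.idx p.1 a * e a b) (fun a => e a b) A

/-- `e^b = ∑ Π_A^b dZ^A = ∑ e^b_a dz^a`. -/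
noncomputable def eForm (e : Matrix (Fin m) (Fin m) ℂ) (p : F.M) (X : (Fin m → ℂ) × GCoord m) :
    Fin m → ℂ :=
  F.dZ p.1 X.1 ᵥ* F.PiMat p.1 e

/-- `E^b = -(i/2) e^(φ - K/2) ∑ Π_A^b N^AB (db_B - conj(F_BC) da^C)`. -/
noncomputable def EForm (e : Matrix (Fin m) (Fin m) ℂ) (p : F.M) (X : (Fin m → ℂ) × GCoord m) :
    Fin m → ℂ :=
  (-(Complex.I / 2) * (Real.exp (p.2.1 - F.K p.1 / 2) : ℂ)) •
    ((F.NinvC *ᵥ star (F.dbFda X)) ᵥ* F.PiMat p.1 e)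

theorem dbFda_add (X Y : (Fin m → ℂ) × GCoord m) :
    F.dbFda (X + Y) = F.dbFda X + F.dbFda Y := by
  have h : ∀ f g : Fin (m + 1) → ℝ, (fun B => (((f + g) B : ℝ) : ℂ))
      = (fun B => (f B : ℂ)) + fun B => (g B : ℂ) := fun f g => by ext B; simp
  simp only [dbFda, Prod.snd_add, Prod.fst_add, h, Matrix.mulVec_add]
  abel

theorem dbFda_smul (r : ℝ) (X : (Fin m → ℂ) × GCoord m) :
    F.dbFda (r • X) = r • F.dbFda X := by
  have h : ∀ f : Fin (m + 1) → ℝ, (fun B => (((r • f) B : ℝ) : ℂ))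
      = r • (fun B => (f B : ℂ)) := fun f => by ext B; simp
  simp only [dbFda, Prod.smul_snd, Prod.smul_fst, h, Matrix.mulVec_smul, smul_sub]

theorem dZ_add (p : F.Msk) (ζ ξ : Fin m → ℂ) : F.dZ p (ζ + ξ) = F.dZ p ζ + F.dZ p ξ := by
  unfold dZ
  ext A
  induction A using p.1.idx.succAboveCases with
  | x => simp
  | p a => simp

theorem dZ_smul (p : F.Msk) (r : ℝ) (ζ : Fin m → ℂ) : F.dZ p (r • ζ) = r • F.dZ p ζ := by
  unfold dZ
  ext A
  induction A using p.1.idx.succAboveCases with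
  | x => simp
  | p a => simp

/-- The system of one-forms `(u, v̄, e^b, Ē^b)` at a point, with respect to the coordinate coframe
`e^a = dz^a` of `M_sk`. -/
noncomputable def theta (p : F.M) :
    ((Fin m → ℂ) × GCoord m) →ₗ[ℝ] ℂ × ℂ × (Fin m → ℂ) × (Fin m → ℂ) where
  toFun X := (F.uForm p X, star (F.vForm p X), F.eForm 1 p X, star (F.EForm 1 p X))
  map_add' X Y := by
    refine Prod.ext ?_ (Prod.ext ?_ (Prod.ext ?_ ?_))
    · simp only [uForm, dbFda_add, dotProduct_add, Prod.fst_add]; ring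
    · simp only [Prod.snd_add, Prod.fst_add, ← star_add]
      congr 1
      simp only [vForm, Prod.snd_add, Prod.fst_add, dotProduct_add]
      push_cast; ring
    · simp only [eForm, Prod.snd_add, Prod.fst_add, dZ_add, Matrix.add_vecMul]
    · simp only [Prod.snd_add, ← star_add]
      congr 1
      simp only [EForm, dbFda_add, star_add, Matrix.mulVec_add, Matrix.add_vecMul, smul_add]
  map_smul' r X := by
    refine Prod.ext ?_ (Prod.ext ?_ (Prod.ext ?_ ?_))
    · simp only [uForm, dbFda_smul, dotProduct_smul, Prod.smul_fst, RingHom.id_apply,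
        Complex.real_smul]; ring
    · simp only [Prod.smul_snd, Prod.smul_fst, RingHom.id_apply]
      rw [show r • star (F.vForm p X) = star (r • F.vForm p X) by simp]
      congr 1
      simp only [vForm, Prod.smul_snd, Prod.smul_fst, dotProduct_smul, smul_eq_mul,
        Complex.real_smul]
      push_cast; ring
    · simp only [eForm, Prod.smul_snd, Prod.smul_fst, dZ_smul, Matrix.smul_vecMul,
        RingHom.id_apply]
    · simp only [Prod.smul_snd, RingHom.id_apply]
      rw [show r • star (F.EForm 1 p X) = star (r • F.EForm 1 p X) by simp]
      congr 1
      simp only [EForm, dbFda_smul, star_smul, star_trivial, Matrix.mulVec_smul,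
        Matrix.smul_vecMul]
      exact smul_comm _ _ _

/-- `N_AB` is invertible. -/
theorem isUnit_N : IsUnit F.N := by
  rw [← Matrix.mulVec_injective_iff_isUnit, ← Matrix.coe_mulVecLin, ← LinearMap.ker_eq_bot,
    LinearMap.ker_eq_bot']
  intro x hx
  rw [Matrix.mulVecLin_apply] at hx
  have hT : F.N.transpose = F.N := by
    ext A B
    exact congrArg Complex.im (congrFun (congrFun (hessMatrix_symm F.poly) A) B)
  have hx' : x ᵥ* F.N = 0 := by rw [← Matrix.mulVec_transpose, hT, hx]
  have h := QuadraticForm.sigPos_add_sigNeg_add_radical (Q := (imHess F.poly).toQuadraticForm')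
  rw [F.sigPos_eq, F.sigNeg_eq, Module.finrank_fin_fun] at h
  have h0 : Module.finrank ℝ (imHess F.poly).toQuadraticForm'.radical = 0 := by omega
  have h1 := Submodule.finrank_eq_zero.1 h0
  have h2 : x ∈ (imHess F.poly).toQuadraticForm'.radical := by
    rw [QuadraticMap.mem_radical_iff']
    have hQ : ∀ y, (imHess F.poly).toQuadraticForm' y = y ⬝ᵥ F.N *ᵥ y := by
      intro y
      simp [Matrix.toQuadraticForm', Matrix.toLinearMap₂'_apply']
    refine ⟨by rw [hQ, hx, dotProduct_zero], fun n => ?_⟩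
    rw [hQ, hQ, Matrix.mulVec_add, hx, zero_add, add_dotProduct, Matrix.dotProduct_mulVec x, hx',
      zero_dotProduct, zero_add]
  rw [h1] at h2
  simpa using h2

theorem herm_Z_pos (p : F.Msk) : 0 < (F.herm (F.Z p) (F.Z p)).re := by
  have hi := p.1.rep_idx_ne_zero
  have h : p.1.rep = p.1.rep p.1.idx • F.Z p := by
    ext A
    induction A using p.1.idx.succAboveCases with
    | x => simp [Z, CP.affVec]
    | p a => simp [Z, CP.affVec, CP.coord]; field_simp
  have hp : 0 < (F.herm p.1.rep p.1.rep).re := p.2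
  rw [h] at hp
  exact (F.herm_smul_re_pos_iff hi _).1 hp

theorem dZ_vecMul_PiMat (p : F.Msk) (ζ : Fin m → ℂ) (e : Matrix (Fin m) (Fin m) ℂ) :
    F.dZ p ζ ᵥ* F.PiMat p e = ζ ᵥ* e := by
  ext b
  simp only [Matrix.vecMul, dotProduct]
  rw [Fin.sum_univ_succAbove _ p.1.idx]
  simp [dZ, PiMat]

theorem vecMul_PiMat (p : F.Msk) (y : Fin (m + 1) → ℂ) (e : Matrix (Fin m) (Fin m) ℂ) :
    y ᵥ* F.PiMat p e = (y ᵥ* F.PiMat p 1) ᵥ* e := by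
  have h : F.PiMat p e = F.PiMat p 1 * e := by
    ext A b
    rw [Matrix.mul_apply]
    induction A using p.1.idx.succAboveCases with
    | x => simp [PiMat, Matrix.one_apply]
    | p a => simp [PiMat, Matrix.one_apply]
  rw [h, Matrix.vecMul_vecMul]

theorem eq_smul_Z_of_vecMul_PiMat_eq_zero (p : F.Msk) (y : Fin (m + 1) → ℂ)
    (h : y ᵥ* F.PiMat p 1 = 0) : y = y p.1.idx • F.Z p := by
  ext A
  induction A using p.1.idx.succAboveCases with
  | x => simp [Z, CP.affVec]
  | p a =>
    have h' := congrFun h a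
    simp only [Matrix.vecMul, dotProduct] at h'
    rw [Fin.sum_univ_succAbove _ p.1.idx] at h'
    simp only [PiMat, Matrix.of_apply, Fin.insertNth_apply_same, Fin.insertNth_apply_succAbove,
      Matrix.one_apply, Pi.zero_apply, mul_ite, mul_one, mul_zero, Finset.sum_ite_eq',
      Finset.mem_univ, if_true] at h'
    simp only [Pi.smul_apply, smul_eq_mul, Z, CP.affVec, Fin.insertNth_apply_succAbove]
    linear_combination h'

theorem theta_injective (p : F.M) : Function.Injective (F.theta p) := by
  rw [← LinearMap.ker_eq_bot, LinearMap.ker_eq_bot']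
  intro X h
  have hu : F.uForm p X = 0 := congrArg (fun t => t.1) h
  have hv : F.vForm p X = 0 := star_eq_zero.1 (congrArg (fun t => t.2.1) h)
  have he : F.eForm 1 p X = 0 := congrArg (fun t => t.2.2.1) h
  have hE : F.EForm 1 p X = 0 := star_eq_zero.1 (congrArg (fun t => t.2.2.2) h)
  have h1 : X.1 = 0 := by
    rwa [eForm, dZ_vecMul_PiMat, Matrix.vecMul_one] at he
  have hN := F.isUnit_N
  have hdet : IsUnit F.N.det := (Matrix.isUnit_iff_isUnit_det _).1 hN
  have hNN : F.NC * F.NinvC = 1 := by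
    have h := congrArg Complex.ofRealHom.mapMatrix (Matrix.mul_nonsing_inv F.N hdet)
    rw [map_mul, map_one] at h
    exact h
  -- the covector `db - F da` vanishes
  have hw : F.dbFda X = 0 := by
    have hZ : F.Z p.1 ⬝ᵥ F.dbFda X = 0 := by
      simpa [uForm, Complex.exp_ne_zero] using hu
    have hP : (F.NinvC *ᵥ star (F.dbFda X)) ᵥ* F.PiMat p.1 1 = 0 := by
      rw [EForm, smul_eq_zero] at hE
      refine hE.resolve_left ?_
      simp [Complex.exp_ne_zero]
    have hy := F.eq_smul_Z_of_vecMul_PiMat_eq_zero p.1 _ hP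
    set c := (F.NinvC *ᵥ star (F.dbFda X)) p.1.1.idx with hc
    have hs : star (F.dbFda X) = c • (F.NC *ᵥ F.Z p.1) := by
      rw [← Matrix.mulVec_smul, ← hy, Matrix.mulVec_mulVec, hNN, Matrix.one_mulVec]
    have hstarN : ∀ x, star (F.NC *ᵥ x) = F.NC *ᵥ star x := by
      intro x; ext A
      simp [Matrix.mulVec, dotProduct, imHess]
    have hs' : F.dbFda X = star c • (F.NC *ᵥ star (F.Z p.1)) := by
      rw [← star_star (F.dbFda X), hs, star_smul, hstarN]
    rw [hs', dotProduct_smul, smul_eq_mul, mul_eq_zero] at hZ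
    have hpos := F.herm_Z_pos p.1
    have hc0 : star c = 0 := hZ.resolve_right fun h0 => by
      rw [herm, h0] at hpos; simp at hpos
    rw [hs', hc0, zero_smul]
  have ha : X.2.2.2.1 = 0 := by
    have him : F.N *ᵥ X.2.2.2.1 = 0 := by
      ext A
      have := congrArg Complex.im (congrFun hw A)
      simpa [dbFda, Matrix.mulVec, dotProduct, imHess] using this
    exact Matrix.mulVec_injective_of_isUnit hN (by rw [him, Matrix.mulVec_zero])
  have hb : X.2.2.2.2 = 0 := by
    ext A
    have := congrFun hw A
    simp only [dbFda, ha, Pi.sub_apply, Pi.zero_apply, Complex.ofReal_zero] at this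
    rw [show (fun _ : Fin (m + 1) => (0 : ℂ)) = 0 from rfl, Matrix.mulVec_zero] at this
    simpa using this
  have hv' : ((-2 * Real.exp (-2 * p.2.1) * X.2.1 : ℝ) : ℂ) +
      Complex.I * ((X.2.2.1 : ℝ) : ℂ) = 0 := by
    simpa [vForm, ha, hb, Complex.exp_ne_zero] using hv
  have hphi : X.2.1 = 0 := by
    have := congrArg Complex.re hv'
    rw [Complex.add_re, Complex.ofReal_re] at this
    simpa [Real.exp_ne_zero] using this
  have hphit : X.2.2.1 = 0 := by
    have := congrArg Complex.im hv'
    rw [Complex.add_im, Complex.ofReal_im] at this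
    simpa using this
  exact Prod.ext h1 (Prod.ext hphi (Prod.ext hphit (Prod.ext ha hb)))

/-- `(u, v̄, e^b, Ē^b)` as an isomorphism of real vector spaces. -/
noncomputable def thetaEquiv (p : F.M) :
    ((Fin m → ℂ) × GCoord m) ≃ₗ[ℝ] ℂ × ℂ × (Fin m → ℂ) × (Fin m → ℂ) :=
  LinearEquiv.ofInjectiveOfFinrankEq (F.theta p) (F.theta_injective p) (by
    simp [Module.finrank_prod, Module.finrank_pi_fintype]
    ring)

/-- The model with corners of the real manifold `M = M_sk × G`. -/
noncomputable abbrev modelM (m : ℕ) :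
    ModelWithCorners ℝ ((Fin m → ℂ) × GCoord m) (ModelProd (Fin m → ℂ) (GCoord m)) :=
  𝓘(ℝ, Fin m → ℂ).prod 𝓘(ℝ, GCoord m)

/-- The endomorphism `J₃` of the tangent space at `p`, defined by declaring the one-forms
`u, v̄, e^b, Ē^b` to be of type `(1,0)`. -/
noncomputable def J3Lin (p : F.M) : ((Fin m → ℂ) × GCoord m) →ₗ[ℝ] (Fin m → ℂ) × GCoord m :=
  (F.thetaEquiv p).symm.toLinearMap ∘ₗ
    DistribSMul.toLinearMap ℝ (ℂ × ℂ × (Fin m → ℂ) × (Fin m → ℂ)) Complex.I ∘ₗ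
      (F.thetaEquiv p).toLinearMap

/-- The almost complex structure `J₃` on `M = M_sk × G`. -/
noncomputable def J3 : TangentEndField (modelM m) F.M := fun p => F.J3Lin p

theorem theta_J3Lin (p : F.M) (X : (Fin m → ℂ) × GCoord m) :
    F.theta p (F.J3Lin p X) = Complex.I • F.theta p X :=
  (F.thetaEquiv p).apply_symm_apply _

theorem J3Lin_J3Lin (p : F.M) (X : (Fin m → ℂ) × GCoord m) :
    F.J3Lin p (F.J3Lin p X) = -X := by
  apply F.theta_injective p
  rw [theta_J3Lin, theta_J3Lin, smul_smul, Complex.I_mul_I, neg_one_smul, map_neg]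

/-- For every coframe `e^b = ∑ e^b_a dz^a` of `M_sk`, in particular a unitary one, the forms
`u`, `v̄`, `e^b`, `Ē^b` are of type `(1,0)` with respect to `J₃`; that is, the quaternionic vielbein
`U = ((ū, ē, -v, -E), (v̄, Ē, u, e)) / √2` satisfies `U ∘ J₃ = -i σ₃ U`. -/
theorem vielbein_J3Lin (e : Matrix (Fin m) (Fin m) ℂ) (p : F.M) (X : (Fin m → ℂ) × GCoord m) :
    F.uForm p (F.J3Lin p X) = Complex.I * F.uForm p X ∧
    F.vForm p (F.J3Lin p X) = -Complex.I * F.vForm p X ∧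
    F.eForm e p (F.J3Lin p X) = Complex.I • F.eForm e p X ∧
    F.EForm e p (F.J3Lin p X) = -Complex.I • F.EForm e p X := by
  have h := F.theta_J3Lin p X
  have hE : ∀ Y, F.EForm e p Y = F.EForm 1 p Y ᵥ* e := fun Y => by
    simp only [EForm, Matrix.smul_vecMul]
    rw [vecMul_PiMat]
  have he : ∀ Y, F.eForm e p Y = F.eForm 1 p Y ᵥ* e := fun Y => by
    simp only [eForm]
    rw [vecMul_PiMat]
  refine ⟨congrArg (fun t => t.1) h, ?_, ?_, ?_⟩
  · have h2 : star (F.vForm p (F.J3Lin p X)) = Complex.I * star (F.vForm p X) :=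
      congrArg (fun t => t.2.1) h
    rw [← star_star (F.vForm p (F.J3Lin p X)), h2]
    simp
  · have h2 : F.eForm 1 p (F.J3Lin p X) = Complex.I • F.eForm 1 p X :=
      congrArg (fun t => t.2.2.1) h
    rw [he, he, h2, Matrix.smul_vecMul]
  · have h2 : star (F.EForm 1 p (F.J3Lin p X)) = Complex.I • star (F.EForm 1 p X) :=
      congrArg (fun t => t.2.2.2) h
    rw [hE, hE, ← star_star (F.EForm 1 p (F.J3Lin p X)), h2, star_smul, star_star,
      Matrix.smul_vecMul]
    simp

end QuadraticPrepotential

/-! ## Complex hyperbolic space and the domain `F(n+1)` -/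

/-- The unit ball in `ℂ^m`, the underlying complex manifold of complex hyperbolic space
`H_ℂ^m`. -/
def complexHyperbolicSpace (m : ℕ) : TopologicalSpace.Opens (Fin m → ℂ) where
  carrier := {z | ∑ a, Complex.normSq (z a) < 1}
  is_open' := isOpen_lt
    (continuous_finsetSum _ fun a _ => Complex.continuous_normSq.comp (continuous_apply a))
    continuous_const

/-- The complex hyperbolic metric (of constant holomorphic sectional curvature `-4`) on the unit
ball, with Kähler potential `-log (1 - |z|²)`, evaluated on `(ζ, ζ)`. -/
noncomputable def hyperbolicMetric {m : ℕ} (z : complexHyperbolicSpace m)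
    (ζ : TangentSpace 𝓘(ℝ, Fin m → ℂ) z) : ℝ :=
  let z' : Fin m → ℂ := z
  let ζ' : Fin m → ℂ := ζ
  (∑ a, Complex.normSq (ζ' a)) / (1 - ∑ a, Complex.normSq (z' a)) +
    Complex.normSq (∑ a, ζ' a * conj (z' a)) / (1 - ∑ a, Complex.normSq (z' a)) ^ 2

/-- The domain `F(n + 1)`, `n = m + 1`, of all `(w^0, (w_1, …, w_n)) ∈ ℂ × ℂ^n = ℂ^(n+1)` with
`Re w^0 > ∑_{A < n} (Im w_A)² - (Im w_n)²`. -/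
def fibreDomain (m : ℕ) : TopologicalSpace.Opens (ℂ × (Fin (m + 1) → ℂ)) where
  carrier := {w | ∑ a : Fin m, (w.2 a.castSucc).im ^ 2 - (w.2 (Fin.last m)).im ^ 2 < w.1.re}
  is_open' := by
    refine isOpen_lt ?_ ?_
    · have h : ∀ A : Fin (m + 1),
          Continuous fun w : ℂ × (Fin (m + 1) → ℂ) => (w.2 A).im ^ 2 := fun A =>
        (Complex.continuous_im.comp ((continuous_apply A).comp continuous_snd)).pow 2
      exact (continuous_finsetSum _ fun a _ => h a.castSucc).sub (h _)
    · exact Complex.continuous_re.comp continuous_fst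

/-- The model with corners (over `ℝ`) of the product of an `m`-dimensional complex manifold with
the domain `F(n + 1)`. -/
noncomputable abbrev modelProd (m : ℕ) :
    ModelWithCorners ℝ ((Fin m → ℂ) × (ℂ × (Fin (m + 1) → ℂ)))
      (ModelProd (Fin m → ℂ) (ℂ × (Fin (m + 1) → ℂ))) :=
  𝓘(ℝ, Fin m → ℂ).prod 𝓘(ℝ, ℂ × (Fin (m + 1) → ℂ))

/-! The point is that `F_AB` is constant, so `c_A = b_A - F_AB a^B` are functions on `G` alone. The
form `u` is a multiple of `Z^A dc_A`, and `Ē^b` is a multiple of `conj Π N⁻¹ dc`. These combinations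
determine `dc`: a covector killed by all of them is proportional to `N conj Z`, and pairing it with
`Z` then gives a multiple of `Z N conj Z > 0` (`eq_zero_of_dotProduct_Z_eq_zero`). Hence every
`dc_A` is of type `(1,0)` (`cCoord_J3Lin`), although `u` and `Ē^b` vary with the base point.

The remaining form is integrated by `w^0 = e^(-2φ) - iφ̃ - i a^A c_A`: the symmetry of `F_AB` gives
`dw^0 = 2e^(-2φ) v̄ - 2i a^A dc_A` (`dw0_eq`), so `dw^0` is of type `(1,0)` too. Thus `J₃` is a
product structure: multiplication by `i` on the base (`fst_J3Lin`) and on the coordinates `(w^0, c)`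
of `G`. Integrability needs no separate argument.

To identify the fibre, Sylvester's theorem provides a real `Q` with `Qᵀ N Q = diag(-1, …, -1, 1)`,
and `w = Qᵀ c`. Since `Im c = -N a`, one has `Re w^0 = e^(-2φ) - aᵀNa`, and `aᵀNa` is the Lorentzian
square of `Im w`. The inequality defining `F(n+1)` therefore says exactly that `e^(-2φ) > 0`, and a
logarithm inverts the coordinate map (`fibreDiffeo`).

The same `Q` turns the Hermitian form on the base into `|x_n|² - ∑ |x_a|²`, so that the quotients
`x_a / x_n` of `x = Q⁻¹Z` map `M_sk` onto the ball (`hypDiffeo`). Products of base and fibre maps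
then give both biholomorphisms. -/

/-! ### Sylvester normal form in signature `(1, m)`. -/

/-- The diagonal matrix `diag (-1, …, -1, 1)`. -/
def lorentz (m : ℕ) : Matrix (Fin (m + 1)) (Fin (m + 1)) ℝ :=
  Matrix.diagonal (Fin.lastCases 1 fun _ => -1)

theorem lorentz_mul_self (m : ℕ) : lorentz m * lorentz m = 1 := by
  rw [lorentz, Matrix.diagonal_mul_diagonal, ← Matrix.diagonal_one]
  congr 1
  ext A
  induction A using Fin.lastCases <;> simp

theorem dotProduct_lorentz_mulVec {m : ℕ} (x y : Fin (m + 1) → ℝ) :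
    x ⬝ᵥ lorentz m *ᵥ y
      = x (Fin.last m) * y (Fin.last m) - ∑ a : Fin m, x a.castSucc * y a.castSucc := by
  simp [lorentz, Matrix.mulVec_diagonal, dotProduct, Fin.sum_univ_castSucc]
  ring

/-- A sum of squares with signs `±1`, exactly one of which is positive, can be reindexed so that the
last sign is the positive one. -/
theorem exists_perm_eq_lastCases {m : ℕ} {w : Fin (m + 1) → ℝ} (hw : ∀ i, w i = -1 ∨ w i = 1)
    (h : {i | 0 < w i}.ncard = 1) :
    ∃ σ : Equiv.Perm (Fin (m + 1)), ∀ i,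
      w (σ i) = Fin.lastCases (motive := fun _ => ℝ) 1 (fun _ => -1) i := by
  obtain ⟨k, hk⟩ := Set.ncard_eq_one.1 h
  have hk' : ∀ i, 0 < w i ↔ i = k := fun i => Set.ext_iff.1 hk i
  refine ⟨Equiv.swap (Fin.last m) k, fun i => ?_⟩
  induction i using Fin.lastCases with
  | last =>
    rw [Equiv.swap_apply_left, Fin.lastCases_last]
    have := (hk' k).2 rfl
    rcases hw k with h | h
    · linarith
    · exact h
  | cast a =>
    rw [Fin.lastCases_castSucc]
    refine (hw _).resolve_right fun h => ?_
    -- A positive sign here would sit at `k`; undoing the swap, `a.castSucc` would be the last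
    -- index.
    have h1 := (hk' _).1 (h ▸ one_pos)
    have h2 := congrArg (Equiv.swap (Fin.last m) k) h1
    simp only [Equiv.swap_apply_self, Equiv.swap_apply_right] at h2
    exact Fin.castSucc_ne_last a h2

/-- Sylvester's normal form of a nondegenerate symmetric matrix of signature `(1, m)`. -/
theorem exists_transpose_mul_mul_eq_lorentz {m : ℕ} (N : Matrix (Fin (m + 1)) (Fin (m + 1)) ℝ)
    (hT : N.transpose = N) (hpos : sigPos N.toQuadraticForm' = 1)
    (hneg : sigNeg N.toQuadraticForm' = m) :
    ∃ Q : Matrix (Fin (m + 1)) (Fin (m + 1)) ℝ, Q.transpose * N * Q = lorentz m := by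
  have hQN : ∀ y, N.toQuadraticForm' y = y ⬝ᵥ N *ᵥ y := by
    intro y
    simp [Matrix.toQuadraticForm', Matrix.toLinearMap₂'_apply']
  obtain ⟨w, hw, he⟩ := QuadraticForm.equivalent_one_zero_neg_one_weighted_sum_squared
    N.toQuadraticForm'
  have hfr : Module.finrank ℝ (Fin (m + 1) → ℝ) = m + 1 := Module.finrank_fin_fun ℝ
  -- The weights are indexed by `Fin (finrank ..)`, so `w` has to be generalised before the
  -- dimension can be rewritten to `m + 1`.
  revert w
  rw [hfr]
  intro w hw he
  have hp : {i | 0 < w i}.ncard = 1 := by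
    rw [← QuadraticForm.sigPos_weightedSumSquares, ← he.sigPos_eq, hpos]
  have hn : {i | w i < 0}.ncard = m := by
    rw [← QuadraticForm.sigNeg_weightedSumSquares, ← he.sigNeg_eq, hneg]
  -- The one positive and the `m` negative weights already exhaust the `m + 1` indices, which
  -- excludes the weight `0`.
  have hw' : ∀ i, w i = -1 ∨ w i = 1 := by
    intro i
    have hd : Disjoint {i | 0 < w i} {i | w i < 0} := by
      rw [Set.disjoint_left]
      intro i h1 h2
      exact lt_asymm (show 0 < w i from h1) h2
    have hc : ({i | 0 < w i} ∪ {i | w i < 0}).ncard = m + 1 := by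
      rw [Set.ncard_union_eq hd, hp, hn, add_comm]
    have hu : {i | 0 < w i} ∪ {i | w i < 0} = Set.univ := by
      apply Set.eq_of_subset_of_ncard_le (Set.subset_univ _)
      rw [hc, Set.ncard_univ]; simp
    have hi : i ∈ {i | 0 < w i} ∪ {i | w i < 0} := hu ▸ Set.mem_univ i
    rcases hw i with h | h | h
    · exact Or.inl h
    · rcases hi with hi | hi <;> simp [h] at hi
    · exact Or.inr h
  obtain ⟨σ, hσ⟩ := exists_perm_eq_lastCases hw' hp
  obtain ⟨e⟩ := he
  let q : (Fin (m + 1) → ℝ) →ₗ[ℝ] (Fin (m + 1) → ℝ) :=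
    e.symm.toLinearEquiv.toLinearMap ∘ₗ (LinearMap.funLeft ℝ ℝ σ.symm)
  have hq : ∀ x, N.toQuadraticForm' (q x) = x ⬝ᵥ lorentz m *ᵥ x := by
    intro x
    have h1 : N.toQuadraticForm' (q x) = QuadraticMap.weightedSumSquares ℝ w (x ∘ σ.symm) :=
      e.symm.map_app _
    rw [h1, QuadraticMap.weightedSumSquares_apply, ← Equiv.sum_comp σ]
    simp only [lorentz, Matrix.mulVec_diagonal, dotProduct, Function.comp, Equiv.symm_apply_apply,
      hσ, smul_eq_mul]
    exact Finset.sum_congr rfl fun _ _ => by ring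
  refine ⟨LinearMap.toMatrix' q, ?_⟩
  set Q := LinearMap.toMatrix' q with hQ
  have hq' : ∀ x, x ⬝ᵥ (Q.transpose * N * Q) *ᵥ x = x ⬝ᵥ lorentz m *ᵥ x := by
    intro x
    rw [← hq, hQN, ← LinearMap.toMatrix'_mulVec q x, ← hQ, ← Matrix.mulVec_mulVec,
      ← Matrix.mulVec_mulVec, Matrix.dotProduct_mulVec x, Matrix.vecMul_transpose]
  -- Equality of quadratic forms is upgraded to equality of matrices by polarisation: a symmetric
  -- `S` with `xᵀSx = 0` for all `x` is tested on basis vectors and on their pairwise sums.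
  set S := Q.transpose * N * Q - lorentz m with hS
  have hST : S.transpose = S := by
    rw [hS, Matrix.transpose_sub, Matrix.transpose_mul, Matrix.transpose_mul, hT,
      Matrix.transpose_transpose, lorentz, Matrix.diagonal_transpose, Matrix.mul_assoc]
  have hSx : ∀ x, x ⬝ᵥ S *ᵥ x = 0 := fun x => by
    rw [hS, Matrix.sub_mulVec, dotProduct_sub, hq', sub_self]
  suffices S = 0 from sub_eq_zero.1 this
  ext i j
  have h1 := hSx (Pi.single i 1 + Pi.single j 1)
  have h2 := hSx (Pi.single i 1)
  have h3 := hSx (Pi.single j 1)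
  have h4 : S j i = S i j := congrFun (congrFun hST i) j
  simp [Matrix.mulVec_add, add_dotProduct] at h1 h2 h3
  simp only [Matrix.zero_apply]
  linarith

/-! ### The real basis change that normalises `N`. -/

namespace QuadraticPrepotential

variable {m : ℕ} (F : QuadraticPrepotential m)

theorem transpose_tau : F.tau.transpose = F.tau := hessMatrix_symm F.poly

theorem transpose_N : F.N.transpose = F.N := by
  ext A B
  exact congrArg Complex.im (congrFun (congrFun F.transpose_tau A) B)

/-- A change of basis bringing `N` to the normal form `diag (-1, …, -1, 1)`. -/
noncomputable def Q : Matrix (Fin (m + 1)) (Fin (m + 1)) ℝ :=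
  (exists_transpose_mul_mul_eq_lorentz F.N F.transpose_N F.sigPos_eq F.sigNeg_eq).choose

theorem transpose_Q_mul_N_mul_Q : F.Q.transpose * F.N * F.Q = lorentz m :=
  (exists_transpose_mul_mul_eq_lorentz F.N F.transpose_N F.sigPos_eq F.sigNeg_eq).choose_spec

/-- The inverse of `Q`. -/
noncomputable def Qinv : Matrix (Fin (m + 1)) (Fin (m + 1)) ℝ :=
  lorentz m * F.Q.transpose * F.N

theorem Qinv_mul_Q : F.Qinv * F.Q = 1 := by
  rw [Qinv, Matrix.mul_assoc, Matrix.mul_assoc, ← Matrix.mul_assoc _ F.N, transpose_Q_mul_N_mul_Q,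
    lorentz_mul_self]

theorem Q_mul_Qinv : F.Q * F.Qinv = 1 := mul_eq_one_comm.1 F.Qinv_mul_Q

/-- As `lorentz m` is an involution, the normal form yields an explicit inverse of `Qᵀ`; this is
what recovers `Re c` from `Re w`. -/
theorem transpose_Q_mul_N_mul_Q_mul_lorentz : F.Q.transpose * (F.N * F.Q * lorentz m) = 1 := by
  rw [← Matrix.mul_assoc, ← Matrix.mul_assoc, transpose_Q_mul_N_mul_Q, lorentz_mul_self]

theorem N_mul_Q_mul_lorentz_mul_transpose_Q : F.N * F.Q * lorentz m * F.Q.transpose = 1 :=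
  mul_eq_one_comm.1 F.transpose_Q_mul_N_mul_Q_mul_lorentz

theorem Q_mul_lorentz_mul_transpose_Q_mul_N : F.Q * lorentz m * F.Q.transpose * F.N = 1 := by
  rw [← F.Q_mul_Qinv, Qinv]
  simp only [Matrix.mul_assoc]

end QuadraticPrepotential

/-! ### Differentials of maps into open submanifolds. -/

section Opens

open TopologicalSpace

variable {𝕜 : Type*} [NontriviallyNormedField 𝕜] {E : Type*} [NormedAddCommGroup E]
  [NormedSpace 𝕜 E] {H : Type*} [TopologicalSpace H] {I : ModelWithCorners 𝕜 E H}
  {E' : Type*} [NormedAddCommGroup E'] [NormedSpace 𝕜 E'] {H' : Type*} [TopologicalSpace H']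
  {I' : ModelWithCorners 𝕜 E' H'}
  {X : Type*} [TopologicalSpace X] [ChartedSpace H X]
  {Y : Type*} [TopologicalSpace Y] [ChartedSpace H' Y]

/-- In the charts of an open subset, the derivative of the inclusion is the identity. -/
theorem hasMFDerivAt_subtype_val (U : Opens X) (x : U) :
    HasMFDerivAt I I (Subtype.val : U → X) x
      (ContinuousLinearMap.id 𝕜 E : TangentSpace I x →L[𝕜] TangentSpace I (x : X)) := by
  refine ⟨continuous_subtype_val.continuousAt, ?_⟩
  -- The preferred chart of `U` at `x` is the restriction of the ambient one, so the two charts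
  -- cancel, but only on the chart target.
  have h : writtenInExtChartAt I I x (Subtype.val : U → X) =ᶠ[nhdsWithin (extChartAt I x x)
      (Set.range I)] id := by
    filter_upwards [extChartAt_target_mem_nhdsWithin x] with y hy
    have := (extChartAt I x).right_inv hy
    exact this
  exact (hasFDerivWithinAt_id _ _).congr_of_eventuallyEq h
    (by simp [writtenInExtChartAt]; rfl)

/-- The inclusion of `V` has the identity as derivative, so by the chain rule a differential can be
computed in the ambient manifold. -/
theorem mfderiv_eq_of_subtype_val_comp {V : Opens Y} {f : X → V} {x : X}
    {f' : TangentSpace I x →L[𝕜] TangentSpace I' ((f x : V) : Y)}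
    (hf : MDifferentiableAt I I' f x)
    (h : HasMFDerivAt I I' (fun x => (f x : Y)) x f') (v : TangentSpace I x) :
    mfderiv I I' f x v = f' v := by
  have h1 := (hasMFDerivAt_subtype_val (I := I') V (f x)).comp x hf.hasMFDerivAt
  have h2 := hasMFDerivAt_unique h h1
  rw [h2]
  rfl

end Opens

namespace Complex

/-- A real matrix acting on complex vectors, on real parts. -/
theorem re_ofReal_mulVec {ι κ : Type*} [Fintype κ] (A : Matrix ι κ ℝ) (z : κ → ℂ) (i : ι) :
    (((A.map (fun x : ℝ => (x : ℂ))) *ᵥ z) i).re = (A *ᵥ fun k => (z k).re) i := by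
  simp [Matrix.mulVec, dotProduct]

/-- A real matrix acting on complex vectors, on imaginary parts. -/
theorem im_ofReal_mulVec {ι κ : Type*} [Fintype κ] (A : Matrix ι κ ℝ) (z : κ → ℂ) (i : ι) :
    (((A.map (fun x : ℝ => (x : ℂ))) *ᵥ z) i).im = (A *ᵥ fun k => (z k).im) i := by
  simp [Matrix.mulVec, dotProduct]

end Complex

/-! ### The coordinates `(w^0, w)` on the fibre, their inverse and their differentials. -/

namespace QuadraticPrepotential

variable {m : ℕ} (F : QuadraticPrepotential m)

/-- The complex coordinates `c_A = b_A - ∑ F_AB a^B` of `G`. -/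
noncomputable def cCoord : GCoord m →ₗ[ℝ] (Fin (m + 1) → ℂ) where
  toFun g := F.dbFda (0, g)
  map_add' g h := by rw [← dbFda_add]; simp
  map_smul' r g := by
    rw [RingHom.id_apply, ← dbFda_smul]; simp

theorem dbFda_eq_cCoord (X : (Fin m → ℂ) × GCoord m) : F.dbFda X = F.cCoord X.2 := rfl

theorem cCoord_eq (g : GCoord m) :
    F.cCoord g = (fun A => (g.2.2.2 A : ℂ)) - F.tau *ᵥ fun B => (g.2.2.1 B : ℂ) := rfl

theorem re_cCoord (g : GCoord m) :
    (fun A => (F.cCoord g A).re) = g.2.2.2 - F.tau.map Complex.re *ᵥ g.2.2.1 := by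
  ext A
  simp [cCoord_eq, Matrix.mulVec, dotProduct]

theorem im_cCoord (g : GCoord m) :
    (fun A => (F.cCoord g A).im) = -(F.N *ᵥ g.2.2.1) := by
  ext A
  simp [cCoord_eq, Matrix.mulVec, dotProduct, imHess]

/-- The coordinates `(w_1, …, w_n)` of `G`. -/
noncomputable def wCoord : GCoord m →ₗ[ℝ] (Fin (m + 1) → ℂ) :=
  ((F.Q.transpose.map (fun x : ℝ => (x : ℂ))).mulVecLin.restrictScalars ℝ) ∘ₗ F.cCoord

theorem wCoord_eq (g : GCoord m) :
    F.wCoord g = F.Q.transpose.map (fun x : ℝ => (x : ℂ)) *ᵥ F.cCoord g := rfl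

theorem re_wCoord (g : GCoord m) :
    (fun A => (F.wCoord g A).re) =
      F.Q.transpose *ᵥ (g.2.2.2 - F.tau.map Complex.re *ᵥ g.2.2.1) := by
  rw [← re_cCoord]
  ext A
  exact Complex.re_ofReal_mulVec _ _ _

theorem im_wCoord (g : GCoord m) :
    (fun A => (F.wCoord g A).im) = -((F.Q.transpose * F.N) *ᵥ g.2.2.1) := by
  rw [← Matrix.mulVec_mulVec, ← Matrix.mulVec_neg, ← im_cCoord]
  ext A
  exact Complex.im_ofReal_mulVec _ _ _

/-- The coordinate `w^0` of `G`. -/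
noncomputable def w0Coord (g : GCoord m) : ℂ :=
  (Real.exp (-2 * g.1) : ℂ) - Complex.I * (g.2.1 : ℂ)
    - Complex.I * ((fun A => (g.2.2.1 A : ℂ)) ⬝ᵥ F.cCoord g)

/-- The vector `(a^A)` in terms of `Im w`. -/
noncomputable def aOfIm (η : Fin (m + 1) → ℝ) : Fin (m + 1) → ℝ := -((F.Q * lorentz m) *ᵥ η)

theorem aOfIm_im_wCoord (g : GCoord m) : F.aOfIm (fun A => (F.wCoord g A).im) = g.2.2.1 := by
  rw [im_wCoord, aOfIm, Matrix.mulVec_neg, neg_neg, Matrix.mulVec_mulVec, ← Matrix.mul_assoc,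
    Q_mul_lorentz_mul_transpose_Q_mul_N, Matrix.one_mulVec]

/-- Congruence by `Q * lorentz m` also brings `N` to `lorentz m`, since `lorentz m` is an
involution; the sign in `aOfIm` drops out of a quadratic expression. -/
theorem aOfIm_quadratic (η : Fin (m + 1) → ℝ) :
    F.aOfIm η ⬝ᵥ F.N *ᵥ F.aOfIm η
      = η (Fin.last m) ^ 2 - ∑ a : Fin m, η a.castSucc ^ 2 := by
  have hl : (lorentz m).transpose = lorentz m := Matrix.diagonal_transpose _
  have h : (F.Q * lorentz m).transpose * F.N * (F.Q * lorentz m) = lorentz m := by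
    rw [Matrix.transpose_mul, hl, ← Matrix.mul_assoc, Matrix.mul_assoc (lorentz m),
      Matrix.mul_assoc (lorentz m), transpose_Q_mul_N_mul_Q, lorentz_mul_self, Matrix.one_mul]
  have h' : η ⬝ᵥ lorentz m *ᵥ η = F.aOfIm η ⬝ᵥ F.N *ᵥ F.aOfIm η := by
    rw [← h, ← Matrix.mulVec_mulVec, ← Matrix.mulVec_mulVec, Matrix.dotProduct_mulVec η,
      Matrix.vecMul_transpose, aOfIm, Matrix.mulVec_neg, neg_dotProduct_neg]
  rw [← h', dotProduct_lorentz_mulVec]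
  simp [sq]

theorem re_ofReal_dotProduct {ι : Type*} [Fintype ι] (a : ι → ℝ) (z : ι → ℂ) :
    ((fun i => (a i : ℂ)) ⬝ᵥ z).re = a ⬝ᵥ fun i => (z i).re := by
  simp [dotProduct]

theorem im_ofReal_dotProduct {ι : Type*} [Fintype ι] (a : ι → ℝ) (z : ι → ℂ) :
    ((fun i => (a i : ℂ)) ⬝ᵥ z).im = a ⬝ᵥ fun i => (z i).im := by
  simp [dotProduct]

/-- The term `-i a·c` contributes `Im (a·c) = -aᵀNa` to the real part. Consequently `e^(-2φ)` is
exactly the gap in the inequality that defines `fibreDomain`. -/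
theorem re_w0Coord (g : GCoord m) :
    (F.w0Coord g).re = Real.exp (-2 * g.1) - g.2.2.1 ⬝ᵥ F.N *ᵥ g.2.2.1 := by
  have h := im_ofReal_dotProduct g.2.2.1 (F.cCoord g)
  rw [im_cCoord, dotProduct_neg] at h
  rw [w0Coord, Complex.sub_re, Complex.sub_re, Complex.I_mul_re, Complex.I_mul_re, h,
    Complex.ofReal_re, Complex.ofReal_im]
  ring

theorem im_w0Coord (g : GCoord m) :
    (F.w0Coord g).im = -g.2.1 - g.2.2.1 ⬝ᵥ (g.2.2.2 - F.tau.map Complex.re *ᵥ g.2.2.1) := by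
  have h := re_ofReal_dotProduct g.2.2.1 (F.cCoord g)
  rw [re_cCoord] at h
  rw [w0Coord, Complex.sub_im, Complex.sub_im, Complex.I_mul_im, Complex.I_mul_im, h,
    Complex.ofReal_re, Complex.ofReal_im]
  ring

theorem quadratic_im_wCoord (g : GCoord m) :
    g.2.2.1 ⬝ᵥ F.N *ᵥ g.2.2.1 = (F.wCoord g (Fin.last m)).im ^ 2 -
      ∑ a : Fin m, (F.wCoord g a.castSucc).im ^ 2 := by
  have h := F.aOfIm_quadratic (fun A => (F.wCoord g A).im)
  rwa [aOfIm_im_wCoord] at h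

theorem wCoord_mem_fibreDomain (g : GCoord m) : (F.w0Coord g, F.wCoord g) ∈ fibreDomain m := by
  change ∑ a : Fin m, (F.wCoord g a.castSucc).im ^ 2 - (F.wCoord g (Fin.last m)).im ^ 2
    < (F.w0Coord g).re
  rw [re_w0Coord, quadratic_im_wCoord]
  linarith [Real.exp_pos (-2 * g.1)]

/-- The vector `Re c` in terms of `Re w`. -/
noncomputable def cOfRe (ξ : Fin (m + 1) → ℝ) : Fin (m + 1) → ℝ := (F.N * F.Q * lorentz m) *ᵥ ξ

/-- The inverse of the coordinate map `(w^0, w)` of `G`. -/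
noncomputable def gOfW (w : ℂ × (Fin (m + 1) → ℂ)) : GCoord m :=
  (-(1 / 2) * Real.log (w.1.re - (∑ a : Fin m, (w.2 a.castSucc).im ^ 2 -
      (w.2 (Fin.last m)).im ^ 2)),
    -w.1.im - F.aOfIm (fun A => (w.2 A).im) ⬝ᵥ F.cOfRe (fun A => (w.2 A).re),
    F.aOfIm (fun A => (w.2 A).im),
    F.cOfRe (fun A => (w.2 A).re) + F.tau.map Complex.re *ᵥ F.aOfIm (fun A => (w.2 A).im))

theorem gOfW_wCoord (g : GCoord m) : F.gOfW (F.w0Coord g, F.wCoord g) = g := by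
  have ha := F.aOfIm_im_wCoord g
  have hc : F.cOfRe (fun A => (F.wCoord g A).re) = g.2.2.2 - F.tau.map Complex.re *ᵥ g.2.2.1 := by
    rw [re_wCoord, cOfRe, Matrix.mulVec_mulVec, N_mul_Q_mul_lorentz_mul_transpose_Q,
      Matrix.one_mulVec]
  have hq := F.quadratic_im_wCoord g
  refine Prod.ext ?_ (Prod.ext ?_ (Prod.ext ?_ ?_))
  · simp only [gOfW, re_w0Coord, hq]
    rw [show ∀ x y s : ℝ, x - (y - s) - (s - y) = x from fun x y s => by ring, Real.log_exp]
    ring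
  · simp only [gOfW, ha, hc, im_w0Coord]
    ring
  · exact ha
  · simp only [gOfW, ha, hc, sub_add_cancel]

/-- Membership in the domain serves to make the argument of the logarithm in `gOfW` positive, so
that exponentiating recovers `Re w^0`. -/
theorem wCoord_gOfW {w : ℂ × (Fin (m + 1) → ℂ)} (hw : w ∈ fibreDomain m) :
    (F.w0Coord (F.gOfW w), F.wCoord (F.gOfW w)) = w := by
  have hre : (fun A => (F.wCoord (F.gOfW w) A).re) = fun A => (w.2 A).re := by
    rw [re_wCoord]
    simp only [gOfW, add_sub_cancel_right, cOfRe, Matrix.mulVec_mulVec]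
    rw [transpose_Q_mul_N_mul_Q_mul_lorentz, Matrix.one_mulVec]
  have him : (fun A => (F.wCoord (F.gOfW w) A).im) = fun A => (w.2 A).im := by
    rw [im_wCoord]
    simp only [gOfW, aOfIm, Matrix.mulVec_neg, neg_neg, Matrix.mulVec_mulVec]
    rw [Matrix.mul_assoc, ← Matrix.mul_assoc F.N, transpose_Q_mul_N_mul_Q_mul_lorentz,
      Matrix.one_mulVec]
  have hw' : 0 < w.1.re - (∑ a : Fin m, (w.2 a.castSucc).im ^ 2 - (w.2 (Fin.last m)).im ^ 2) :=
    sub_pos.2 hw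
  refine Prod.ext (Complex.ext ?_ ?_) (funext fun A => Complex.ext (congrFun hre A)
    (congrFun him A))
  · rw [re_w0Coord]
    simp only [gOfW, aOfIm_quadratic]
    rw [show ∀ x : ℝ, -2 * (-(1 / 2) * x) = x from fun x => by ring, Real.exp_log hw']
    ring
  · rw [im_w0Coord]
    simp only [gOfW, add_sub_cancel_right]
    ring

theorem contDiff_cCoord : ContDiff ℝ ∞ F.cCoord := F.cCoord.toContinuousLinearMap.contDiff

theorem contDiff_wCoord : ContDiff ℝ ∞ F.wCoord := F.wCoord.toContinuousLinearMap.contDiff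

theorem contDiff_w0Coord : ContDiff ℝ ∞ F.w0Coord := by
  unfold w0Coord
  have h : ∀ A, ContDiff ℝ ∞ fun g => F.cCoord g A := fun A =>
    (contDiff_apply ℝ ℂ A).comp F.contDiff_cCoord
  have hr : ∀ f : GCoord m → ℝ, ContDiff ℝ ∞ f → ContDiff ℝ ∞ fun g => (f g : ℂ) := fun f hf =>
    Complex.ofRealCLM.contDiff.comp hf
  refine ContDiff.sub (ContDiff.sub (hr _ ?_) (contDiff_const.mul (hr _ ?_)))
    (contDiff_const.mul ?_)
  · fun_prop
  · fun_prop
  · simp only [dotProduct]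
    refine ContDiff.sum fun A _ => (hr _ ?_).mul (h A)
    fun_prop

theorem contDiffOn_gOfW : ContDiffOn ℝ ∞ F.gOfW (fibreDomain m) := by
  have him : ∀ A, ContDiff ℝ ∞ fun w : ℂ × (Fin (m + 1) → ℂ) => (w.2 A).im := fun A =>
    Complex.imCLM.contDiff.comp (by fun_prop)
  have hre : ∀ A, ContDiff ℝ ∞ fun w : ℂ × (Fin (m + 1) → ℂ) => (w.2 A).re := fun A =>
    Complex.reCLM.contDiff.comp (by fun_prop)
  have him0 : ContDiff ℝ ∞ fun w : ℂ × (Fin (m + 1) → ℂ) => w.1.im :=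
    Complex.imCLM.contDiff.comp (by fun_prop)
  have hre0 : ContDiff ℝ ∞ fun w : ℂ × (Fin (m + 1) → ℂ) => w.1.re :=
    Complex.reCLM.contDiff.comp (by fun_prop)
  have hmul : ∀ (A : Matrix (Fin (m + 1)) (Fin (m + 1)) ℝ), ContDiff ℝ ∞ fun v => A *ᵥ v :=
    fun A => A.mulVecLin.toContinuousLinearMap.contDiff
  have ha : ContDiff ℝ ∞ fun w : ℂ × (Fin (m + 1) → ℂ) => F.aOfIm (fun A => (w.2 A).im) :=
    ((hmul _).comp (contDiff_pi.2 him)).neg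
  have hc : ContDiff ℝ ∞ fun w : ℂ × (Fin (m + 1) → ℂ) => F.cOfRe (fun A => (w.2 A).re) :=
    (hmul _).comp (contDiff_pi.2 hre)
  unfold gOfW
  refine ContDiffOn.prodMk ?_ (ContDiff.contDiffOn (ContDiff.prodMk ?_ (ContDiff.prodMk ha
    (hc.add ((hmul _).comp ha)))))
  · refine contDiffOn_const.mul (ContDiffOn.log (ContDiff.contDiffOn (hre0.sub
      ((ContDiff.sum fun a _ => (him _).pow 2).sub ((him _).pow 2)))) fun w hw => ?_)
    exact (sub_pos.2 hw).ne'
  · refine him0.neg.sub ?_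
    simp only [dotProduct]
    exact ContDiff.sum fun A _ => ((contDiff_apply ℝ ℝ A).comp ha).mul
      ((contDiff_apply ℝ ℝ A).comp hc)

/-- The coordinates `(w^0, w)` as a diffeomorphism from `G` to the domain `F(n + 1)`. -/
noncomputable def fibreDiffeo :
    GCoord m ≃ₘ⟮𝓘(ℝ, GCoord m), 𝓘(ℝ, ℂ × (Fin (m + 1) → ℂ))⟯ fibreDomain m where
  toFun g := ⟨(F.w0Coord g, F.wCoord g), F.wCoord_mem_fibreDomain g⟩
  invFun w := F.gOfW w
  left_inv := F.gOfW_wCoord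
  right_inv w := Subtype.ext (F.wCoord_gOfW w.2)
  contMDiff_toFun := by
    rw [← ContMDiff.subtypeVal_comp_iff]
    exact (F.contDiff_w0Coord.prodMk F.contDiff_wCoord).contMDiff
  contMDiff_invFun := fun w => by
    refine (contMDiffAt_subtype_iff (I := 𝓘(ℝ, ℂ × (Fin (m + 1) → ℂ))) (U := fibreDomain m)
      (f := F.gOfW)).2 ?_
    exact (F.contDiffOn_gOfW.contDiffAt ((fibreDomain m).isOpen.mem_nhds w.2)).contMDiffAt

/-- The differential of `w^0`. -/
noncomputable def dw0 (g X : GCoord m) : ℂ :=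
  ((-2 * Real.exp (-2 * g.1) * X.1 : ℝ) : ℂ) - Complex.I * (X.2.1 : ℂ)
    - Complex.I * ((fun A => (X.2.2.1 A : ℂ)) ⬝ᵥ F.cCoord g +
      (fun A => (g.2.2.1 A : ℂ)) ⬝ᵥ F.cCoord X)

/-- Smoothness is already known, so it suffices to differentiate along the line `g + tX`, where only
one-variable rules are needed. -/
theorem fderiv_w0Coord (g X : GCoord m) : fderiv ℝ F.w0Coord g X = F.dw0 g X := by
  have h1 := ((F.contDiff_w0Coord.differentiable (by simp)).differentiableAt
    (x := g)).hasFDerivAt.hasLineDerivAt X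
  refine (h1.lineDeriv.symm.trans (HasLineDerivAt.lineDeriv ?_))
  have hr : ∀ x y : ℝ, HasDerivAt (fun t : ℝ => ((x + t * y : ℝ) : ℂ)) (y : ℂ) 0 := fun x y => by
    have := ((hasDerivAt_mul_const (x := (0 : ℝ)) y).const_add x).ofReal_comp
    exact this
  have he : HasDerivAt (fun t : ℝ => ((Real.exp (-2 * (g.1 + t * X.1)) : ℝ) : ℂ))
      ((-2 * Real.exp (-2 * g.1) * X.1 : ℝ) : ℂ) 0 := by
    have := ((((hasDerivAt_mul_const (x := (0 : ℝ)) X.1).const_add g.1).const_mul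
      (-2)).exp).ofReal_comp
    convert this using 2
    simp; ring
  have hc : ∀ A, HasDerivAt (fun t : ℝ => F.cCoord g A + (t : ℂ) * F.cCoord X A)
      (F.cCoord X A) 0 := fun A => by
    have := ((Complex.ofRealCLM.hasDerivAt (x := (0 : ℝ))).mul_const (F.cCoord X A)).const_add
      (F.cCoord g A)
    simpa using this
  have hs := HasDerivAt.fun_sum (u := Finset.univ) fun A _ =>
    (hr (g.2.2.1 A) (X.2.2.1 A)).mul (hc A)
  have h := (he.sub ((hr g.2.1 X.2.1).const_mul Complex.I)).sub (hs.const_mul Complex.I)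
  unfold HasLineDerivAt
  convert h using 1
  · funext t
    simp only [w0Coord, map_add, map_smul, dotProduct]
    simp
  · simp [dw0, dotProduct, Finset.sum_add_distrib]

/-- The differential of `w^0` in terms of `v̄` and `dc`. -/
theorem dw0_eq (p : F.M) (X : (Fin m → ℂ) × GCoord m) :
    F.dw0 p.2 X.2 = (2 * Real.exp (-2 * p.2.1) : ℝ) * star (F.vForm p X) -
      2 * Complex.I * ((fun A => (p.2.2.2.1 A : ℂ)) ⬝ᵥ F.dbFda X) := by
  have hof : ∀ x y : Fin (m + 1) → ℝ, ((x ⬝ᵥ y : ℝ) : ℂ) =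
      (fun A => (x A : ℂ)) ⬝ᵥ fun A => (y A : ℂ) := fun x y => by simp [dotProduct]
  -- The symmetry of `F_AB` lets the two terms `da F a` and `a F da` combine; without it `w^0` would
  -- not integrate `v̄`.
  have hs : (fun A => (p.2.2.2.1 A : ℂ)) ⬝ᵥ F.tau *ᵥ (fun A => (X.2.2.2.1 A : ℂ)) =
      (fun A => (X.2.2.2.1 A : ℂ)) ⬝ᵥ F.tau *ᵥ (fun A => (p.2.2.2.1 A : ℂ)) := by
    rw [Matrix.dotProduct_mulVec, ← Matrix.mulVec_transpose, transpose_tau, dotProduct_comm]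
  have he : (Real.exp (-2 * p.2.1) : ℂ) * (Real.exp (2 * p.2.1) : ℂ) = 1 := by
    rw [← Complex.ofReal_mul, ← Real.exp_add]; simp
  rw [dbFda_eq_cCoord]
  simp only [dw0, vForm, cCoord_eq, dotProduct_sub, hs, star_mul', star_add, Complex.star_def,
    Complex.conj_I, Complex.conj_ofReal, map_div₀, map_one, map_ofNat]
  simp only [Complex.ofReal_add, Complex.ofReal_sub, Complex.ofReal_mul, hof]
  rw [dotProduct_comm (fun A => (p.2.2.2.2 A : ℂ))]
  generalize (fun A => (X.2.2.2.1 A : ℂ)) ⬝ᵥ F.tau *ᵥ _ = s1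
  generalize (fun A => (X.2.2.2.1 A : ℂ)) ⬝ᵥ _ = s2
  generalize (fun A => (p.2.2.2.1 A : ℂ)) ⬝ᵥ _ = s3
  push_cast at he ⊢
  -- The coefficient is minus the bracket of `v̄`, the factor that `e^(-2φ) e^(2φ)` multiplies.
  linear_combination (-(-2 * Complex.exp (-2 * p.2.1) * X.2.1 +
    -Complex.I * (X.2.2.1 + s2 - s3))) * he

/-- A covector annihilated by `Z` and by `conj Π` (after raising the index) vanishes. -/
theorem eq_zero_of_dotProduct_Z_eq_zero (p : F.Msk) {w : Fin (m + 1) → ℂ} (hZ : F.Z p ⬝ᵥ w = 0)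
    (hP : (F.NinvC *ᵥ star w) ᵥ* F.PiMat p 1 = 0) : w = 0 := by
  have hdet : IsUnit F.N.det := (Matrix.isUnit_iff_isUnit_det _).1 F.isUnit_N
  have hNN : F.NC * F.NinvC = 1 := by
    have h := congrArg Complex.ofRealHom.mapMatrix (Matrix.mul_nonsing_inv F.N hdet)
    rw [map_mul, map_one] at h
    exact h
  -- The kernel of `Π` is the line through `Z`, so `conj w = c N Z`; pairing `w` with `Z` then
  -- leaves `conj c` times a nonzero number.
  have hy := F.eq_smul_Z_of_vecMul_PiMat_eq_zero p _ hP
  set c := (F.NinvC *ᵥ star w) p.1.idx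
  have hs : star w = c • (F.NC *ᵥ F.Z p) := by
    rw [← Matrix.mulVec_smul, ← hy, Matrix.mulVec_mulVec, hNN, Matrix.one_mulVec]
  have hstarN : ∀ x, star (F.NC *ᵥ x) = F.NC *ᵥ star x := by
    intro x; ext A
    simp [Matrix.mulVec, dotProduct, imHess]
  have hs' : w = star c • (F.NC *ᵥ star (F.Z p)) := by
    rw [← star_star w, hs, star_smul, hstarN]
  rw [hs', dotProduct_smul, smul_eq_mul, mul_eq_zero] at hZ
  have hpos := F.herm_Z_pos p
  have hc0 : star c = 0 := hZ.resolve_right fun h0 => by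
    rw [herm, h0] at hpos; simp at hpos
  rw [hs', hc0, zero_smul]

/-! ### `J₃` is multiplication by `i` in the coordinates of base and fibre. -/

theorem fst_J3Lin (p : F.M) (X : (Fin m → ℂ) × GCoord m) :
    (F.J3Lin p X).1 = Complex.I • X.1 := by
  have h := (F.vielbein_J3Lin 1 p X).2.2.1
  simpa only [eForm, dZ_vecMul_PiMat, Matrix.vecMul_one] using h

/-- The defect `dc(J₃X) - i dc(X)` is annihilated by the coefficients of both `u` and `Ē`, hence
vanishes. This removes all dependence of the fibre complex structure on the base point. -/
theorem cCoord_J3Lin (p : F.M) (X : (Fin m → ℂ) × GCoord m) :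
    F.cCoord (F.J3Lin p X).2 = Complex.I • F.cCoord X.2 := by
  obtain ⟨hu, -, -, hE⟩ := F.vielbein_J3Lin 1 p X
  rw [← dbFda_eq_cCoord, ← dbFda_eq_cCoord, ← sub_eq_zero]
  apply F.eq_zero_of_dotProduct_Z_eq_zero p.1
  · rw [dotProduct_sub, dotProduct_smul, sub_eq_zero, smul_eq_mul]
    simp only [uForm] at hu
    have hne : Complex.I * (Real.exp (F.K p.1 / 2 + p.2.1) : ℂ) ≠ 0 := by
      simp [Complex.exp_ne_zero]
    apply mul_left_cancel₀ hne
    linear_combination hu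
  · have hne : -(Complex.I / 2) * (Real.exp (p.2.1 - F.K p.1 / 2) : ℂ) ≠ 0 := by
      simp [Complex.exp_ne_zero]
    -- `E` is conjugate-linear in `dc`, so its eigenvalue `-i` is the conjugate of the `i` wanted
    -- for `dc`.
    simp only [EForm] at hE
    rw [smul_comm (-Complex.I)] at hE
    have hE' := smul_right_injective _ hne hE
    rw [star_sub, star_smul, Matrix.mulVec_sub, Matrix.sub_vecMul, hE', Matrix.mulVec_smul,
      Matrix.smul_vecMul]
    simp

/-- By `dw0_eq`, `dw^0` is a pointwise complex combination of the `(1,0)`-forms `v̄` and `dc`. -/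
theorem dw0_J3Lin (p : F.M) (X : (Fin m → ℂ) × GCoord m) :
    F.dw0 p.2 (F.J3Lin p X).2 = Complex.I * F.dw0 p.2 X.2 := by
  have hv := (F.vielbein_J3Lin 1 p X).2.1
  rw [dw0_eq, dw0_eq, dbFda_eq_cCoord, cCoord_J3Lin, hv, ← dbFda_eq_cCoord, dotProduct_smul]
  simp
  ring

theorem wCoord_J3Lin (p : F.M) (X : (Fin m → ℂ) × GCoord m) :
    F.wCoord (F.J3Lin p X).2 = Complex.I • F.wCoord X.2 := by
  rw [wCoord_eq, cCoord_J3Lin, Matrix.mulVec_smul, ← wCoord_eq]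

theorem mfderiv_fibreDiffeo (g X : GCoord m) :
    mfderiv 𝓘(ℝ, GCoord m) 𝓘(ℝ, ℂ × (Fin (m + 1) → ℂ)) F.fibreDiffeo g X =
      (F.dw0 g X, F.wCoord X) := by
  have h0 := ((F.contDiff_w0Coord.differentiable (by simp)).differentiableAt
    (x := g)).hasFDerivAt
  have h := (h0.prodMk (F.wCoord.toContinuousLinearMap.hasFDerivAt (x := g))).hasMFDerivAt
  rw [← fderiv_w0Coord]
  exact mfderiv_eq_of_subtype_val_comp
    ((F.fibreDiffeo.contMDiff g).mdifferentiableAt (by simp)) h X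

end QuadraticPrepotential

/-! ### Smooth maps into projective space. -/

namespace CP

variable {m : ℕ}

@[simp]
theorem affVec_last_last (z : Fin m → ℂ) : affVec (Fin.last m) z (Fin.last m) = 1 := by
  simp [affVec]

@[simp]
theorem affVec_last_castSucc (z : Fin m → ℂ) (a : Fin m) :
    affVec (Fin.last m) z a.castSucc = z a := by
  rw [← Fin.succAbove_last_apply, affVec, Fin.insertNth_apply_succAbove]

theorem contDiff_affVec (i : Fin (m + 1)) : ContDiff ℝ ∞ (affVec i) := by
  rw [contDiff_pi]
  intro k
  induction k using i.succAboveCases with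
  | x => simpa [affVec] using contDiff_const
  | p a => simpa [affVec] using contDiff_apply ℝ ℂ a

theorem affVec_coord {i : Fin (m + 1)} {p : CP m} (hp : p.rep i ≠ 0) :
    affVec i (coord i p) = (p.rep i)⁻¹ • p.rep := by
  refine (Fin.eq_insertNth_iff.2 ⟨by simpa using inv_mul_cancel₀ hp, ?_⟩).symm
  funext a
  simp [Fin.removeNth, coord, div_eq_inv_mul]

/-- A smooth family of nonzero vectors spans a smooth family of lines. -/
theorem contMDiff_mk {E : Type*} [NormedAddCommGroup E] [NormedSpace ℝ E]
    {f : E → Fin (m + 1) → ℂ} (hf : ContDiff ℝ ∞ f) (h0 : ∀ x, f x ≠ 0) :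
    ContMDiff 𝓘(ℝ, E) 𝓘(ℝ, Fin m → ℂ) ∞ fun x => mk ⟨f x, h0 x⟩ := by
  intro x
  obtain ⟨i, hi⟩ := Function.ne_iff.1 (h0 x)
  have hi : f x i ≠ 0 := hi
  have hfi : ∀ j, ContDiff ℝ ∞ fun x => f x j := fun j => contDiff_pi.1 hf j
  have hU : ∀ᶠ y in nhds x, f y i ≠ 0 :=
    (hfi i).continuous.continuousAt.eventually_ne hi
  have h1 : ContMDiffAt 𝓘(ℝ, E) 𝓘(ℝ, Fin m → ℂ) ∞
      (fun y a => f y (i.succAbove a) / f y i) x := by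
    apply ContDiffAt.contMDiffAt
    refine contDiffAt_pi.2 fun a => ?_
    simp only [div_eq_mul_inv]
    exact (hfi _).contDiffAt.mul ((hfi i).contDiffAt.inv hi)
  -- An affine chart has all of `ℂ^m` as its target, so its inverse is smooth everywhere.
  have h2 : ContMDiff 𝓘(ℝ, Fin m → ℂ) 𝓘(ℝ, Fin m → ℂ) ∞ (chart (m := m) i).symm := by
    have h := contMDiffOn_symm_of_mem_maximalAtlas (I := 𝓘(ℝ, Fin m → ℂ)) (n := ω)
      (IsManifold.subset_maximalAtlas (show chart (m := m) i ∈ atlas (Fin m → ℂ) (CP m) from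
        ⟨i, rfl⟩))
    exact (contMDiffOn_univ.1 h).of_le (by simp)
  refine ((h2 _).comp x h1).congr_of_eventuallyEq ?_
  filter_upwards [hU] with y hy
  have hs : mk ⟨f y, h0 y⟩ ∈ (chart (m := m) i).source := (rep_mk_ne_zero_iff i _).2 hy
  have h := (chart i).left_inv hs
  rw [← h]
  congr 1
  exact coord_mk i _

end CP

/-! ### `M_sk` as the complex hyperbolic ball. -/

namespace QuadraticPrepotential

variable {m : ℕ} (F : QuadraticPrepotential m)

/-- `Q` as a complex matrix. -/
noncomputable abbrev QC : Matrix (Fin (m + 1)) (Fin (m + 1)) ℂ := F.Q.map (fun x : ℝ => (x : ℂ))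

/-- The inverse of `Q` as a complex matrix. -/
noncomputable abbrev QinvC : Matrix (Fin (m + 1)) (Fin (m + 1)) ℂ :=
  F.Qinv.map (fun x : ℝ => (x : ℂ))

theorem ofReal_map_mul {ι : Type*} [Fintype ι] [DecidableEq ι] (A B : Matrix ι ι ℝ) :
    (A * B).map (fun x : ℝ => (x : ℂ)) =
      A.map (fun x : ℝ => (x : ℂ)) * B.map (fun x : ℝ => (x : ℂ)) :=
  map_mul Complex.ofRealHom.mapMatrix A B

theorem QC_mul_QinvC : F.QC * F.QinvC = 1 := by
  rw [← ofReal_map_mul, Q_mul_Qinv]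
  exact map_one Complex.ofRealHom.mapMatrix

theorem QinvC_mul_QC : F.QinvC * F.QC = 1 := mul_eq_one_comm.1 F.QC_mul_QinvC

theorem QC_mulVec_QinvC_mulVec (Z : Fin (m + 1) → ℂ) : F.QC *ᵥ F.QinvC *ᵥ Z = Z := by
  rw [Matrix.mulVec_mulVec, QC_mul_QinvC, Matrix.one_mulVec]

theorem QinvC_mulVec_QC_mulVec (Z : Fin (m + 1) → ℂ) : F.QinvC *ᵥ F.QC *ᵥ Z = Z := by
  rw [Matrix.mulVec_mulVec, QinvC_mul_QC, Matrix.one_mulVec]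

/-- The Hermitian form in the basis in which `N` is in normal form. -/
theorem herm_QC (x y : Fin (m + 1) → ℂ) :
    F.herm (F.QC *ᵥ x) (F.QC *ᵥ y) =
      x (Fin.last m) * conj (y (Fin.last m)) - ∑ a : Fin m, x a.castSucc * conj (y a.castSucc) := by
  have hs : star (F.QC *ᵥ y) = F.QC *ᵥ star y := by
    ext A; simp [Matrix.mulVec, dotProduct]
  have hQ : F.QC.transpose * F.NC * F.QC = (lorentz m).map (fun x : ℝ => (x : ℂ)) := by
    rw [← transpose_Q_mul_N_mul_Q, ofReal_map_mul, ofReal_map_mul, Matrix.transpose_map]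
  have h : F.herm (F.QC *ᵥ x) (F.QC *ᵥ y) =
      x ⬝ᵥ ((lorentz m).map (fun x : ℝ => (x : ℂ))) *ᵥ star y := by
    rw [herm, hs, ← hQ, ← Matrix.mulVec_mulVec, ← Matrix.mulVec_mulVec, Matrix.dotProduct_mulVec x,
      Matrix.vecMul_transpose]
  rw [h]
  have hd : (lorentz m).map (fun x : ℝ => (x : ℂ)) =
      Matrix.diagonal fun A => ((Fin.lastCases (motive := fun _ => ℝ) 1 (fun _ => -1) A : ℝ) : ℂ) :=
    Matrix.diagonal_map (by simp)
  rw [hd]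
  simp [Matrix.mulVec_diagonal, dotProduct, Fin.sum_univ_castSucc]
  ring

theorem herm_eq (Z W : Fin (m + 1) → ℂ) :
    F.herm Z W = (F.QinvC *ᵥ Z) (Fin.last m) * conj ((F.QinvC *ᵥ W) (Fin.last m)) -
      ∑ a : Fin m, (F.QinvC *ᵥ Z) a.castSucc * conj ((F.QinvC *ᵥ W) a.castSucc) := by
  rw [← herm_QC, QC_mulVec_QinvC_mulVec, QC_mulVec_QinvC_mulVec]

theorem re_herm_self (Z : Fin (m + 1) → ℂ) :
    (F.herm Z Z).re = Complex.normSq ((F.QinvC *ᵥ Z) (Fin.last m)) -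
      ∑ a : Fin m, Complex.normSq ((F.QinvC *ᵥ Z) a.castSucc) := by
  simp only [herm_eq, Complex.mul_conj]
  rw [← Complex.ofReal_sum, ← Complex.ofReal_sub, Complex.ofReal_re]

/-- In the normalised basis only the last coordinate contributes positively, so a single affine
chart covers `M_sk`. -/
theorem last_ne_zero_of_pos {Z : Fin (m + 1) → ℂ} (h : 0 < (F.herm Z Z).re) :
    (F.QinvC *ᵥ Z) (Fin.last m) ≠ 0 := by
  intro h0
  rw [re_herm_self, h0, map_zero, zero_sub] at h
  have := Finset.sum_nonneg fun (a : Fin m) (_ : a ∈ Finset.univ) =>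
    Complex.normSq_nonneg ((F.QinvC *ᵥ Z) a.castSucc)
  linarith

/-- The inhomogeneous coordinates `(Q⁻¹ Z)^a / (Q⁻¹ Z)^n`. -/
noncomputable def hypCoord (Z : Fin (m + 1) → ℂ) : Fin m → ℂ :=
  fun a => (F.QinvC *ᵥ Z) a.castSucc / (F.QinvC *ᵥ Z) (Fin.last m)

theorem hypCoord_smul {c : ℂ} (hc : c ≠ 0) (Z : Fin (m + 1) → ℂ) :
    F.hypCoord (c • Z) = F.hypCoord Z := by
  funext a
  simp only [hypCoord, Matrix.mulVec_smul, Pi.smul_apply, smul_eq_mul]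
  exact mul_div_mul_left _ _ hc

theorem hypCoord_rep_mk (Z : {Z : Fin (m + 1) → ℂ // Z ≠ 0}) :
    F.hypCoord (CP.mk Z).rep = F.hypCoord Z := by
  obtain ⟨c, hc, h⟩ := CP.exists_rep_mk Z
  rw [h, hypCoord_smul F hc]

theorem affVec_hypCoord {Z : Fin (m + 1) → ℂ} (h : (F.QinvC *ᵥ Z) (Fin.last m) ≠ 0) :
    CP.affVec (Fin.last m) (F.hypCoord Z) =
      ((F.QinvC *ᵥ Z) (Fin.last m))⁻¹ • F.QinvC *ᵥ Z := by
  ext A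
  induction A using Fin.lastCases with
  | last => simp [h]
  | cast a => simp [hypCoord, div_eq_inv_mul]

theorem hypCoord_mem {Z : Fin (m + 1) → ℂ} (h : 0 < (F.herm Z Z).re) :
    F.hypCoord Z ∈ complexHyperbolicSpace m := by
  have h0 := Complex.normSq_pos.2 (F.last_ne_zero_of_pos h)
  change ∑ a, Complex.normSq (F.hypCoord Z a) < 1
  simp only [hypCoord, Complex.normSq_div]
  rw [← Finset.sum_div, div_lt_one h0]
  rw [re_herm_self] at h
  linarith

/-- Homogeneous coordinates of the point of `M_sk` corresponding to `z` in the unit ball. -/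
noncomputable def hypVec (z : Fin m → ℂ) : Fin (m + 1) → ℂ := F.QC *ᵥ CP.affVec (Fin.last m) z

theorem QinvC_mulVec_hypVec (z : Fin m → ℂ) :
    F.QinvC *ᵥ F.hypVec z = CP.affVec (Fin.last m) z := F.QinvC_mulVec_QC_mulVec _

theorem hypVec_ne_zero (z : Fin m → ℂ) : F.hypVec z ≠ 0 := fun h => by
  have h1 := F.QinvC_mulVec_hypVec z
  rw [h, Matrix.mulVec_zero] at h1
  exact CP.affVec_ne_zero _ _ h1.symm

theorem hypCoord_hypVec (z : Fin m → ℂ) : F.hypCoord (F.hypVec z) = z := by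
  funext a
  simp [hypCoord, QinvC_mulVec_hypVec]

theorem herm_hypVec_pos {z : Fin m → ℂ} (hz : z ∈ complexHyperbolicSpace m) :
    0 < (F.herm (F.hypVec z) (F.hypVec z)).re := by
  have hz : ∑ a, Complex.normSq (z a) < 1 := hz
  rw [re_herm_self, QinvC_mulVec_hypVec]
  simp [hz]

theorem mk_hypVec_mem {z : Fin m → ℂ} (hz : z ∈ complexHyperbolicSpace m) :
    CP.mk ⟨F.hypVec z, F.hypVec_ne_zero z⟩ ∈ F.Msk := by
  obtain ⟨c, hc, h⟩ := CP.exists_rep_mk ⟨F.hypVec z, F.hypVec_ne_zero z⟩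
  change 0 < (F.herm (CP.rep _) (CP.rep _)).re
  rw [h]
  exact (F.herm_smul_re_pos_iff hc _).2 (F.herm_hypVec_pos hz)

theorem contDiff_mulVec (A : Matrix (Fin (m + 1)) (Fin (m + 1)) ℂ) :
    ContDiff ℝ ∞ fun v => A *ᵥ v :=
  (A.mulVecLin.restrictScalars ℝ).toContinuousLinearMap.contDiff

theorem contDiffAt_hypCoord {Z : Fin (m + 1) → ℂ} (h : (F.QinvC *ᵥ Z) (Fin.last m) ≠ 0) :
    ContDiffAt ℝ ∞ F.hypCoord Z := by
  have hA : ∀ A, ContDiff ℝ ∞ fun Z => (F.QinvC *ᵥ Z) A := fun A =>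
    (contDiff_apply ℝ ℂ A).comp (contDiff_mulVec F.QinvC)
  unfold hypCoord
  refine contDiffAt_pi.2 fun a => ?_
  simp only [div_eq_mul_inv]
  exact (hA _).contDiffAt.mul ((hA _).contDiffAt.inv h)

/-- The differential of the inhomogeneous coordinates at `Z`. -/
noncomputable def dHypCoord (Z W : Fin (m + 1) → ℂ) : Fin m → ℂ := fun a =>
  ((F.QinvC *ᵥ W) a.castSucc - (F.QinvC *ᵥ W) (Fin.last m) * F.hypCoord Z a) /
    (F.QinvC *ᵥ Z) (Fin.last m)

theorem fderiv_hypCoord {Z : Fin (m + 1) → ℂ} (h : (F.QinvC *ᵥ Z) (Fin.last m) ≠ 0)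
    (W : Fin (m + 1) → ℂ) : fderiv ℝ F.hypCoord Z W = F.dHypCoord Z W := by
  have h1 := ((F.contDiffAt_hypCoord h).differentiableAt (by simp)).hasFDerivAt.hasLineDerivAt W
  refine (h1.lineDeriv.symm.trans (HasLineDerivAt.lineDeriv ?_))
  have hA : ∀ A, HasDerivAt (fun t : ℝ => (F.QinvC *ᵥ (Z + t • W)) A) ((F.QinvC *ᵥ W) A) 0 := by
    intro A
    have h2 : (fun t : ℝ => (F.QinvC *ᵥ (Z + t • W)) A) =
        fun t : ℝ => (F.QinvC *ᵥ Z) A + (t : ℂ) * (F.QinvC *ᵥ W) A := by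
      funext t
      simp [Matrix.mulVec_add, Matrix.mulVec_smul]
    rw [h2]
    simpa using ((Complex.ofRealCLM.hasDerivAt (x := (0 : ℝ))).mul_const
      ((F.QinvC *ᵥ W) A)).const_add ((F.QinvC *ᵥ Z) A)
  refine hasDerivAt_pi.2 fun a => ?_
  have h3 := (hA a.castSucc).div (hA (Fin.last m)) (by simpa using h)
  refine h3.congr_deriv ?_
  simp only [dHypCoord, hypCoord, zero_smul, add_zero]
  field_simp

theorem dHypCoord_I_smul (Z W : Fin (m + 1) → ℂ) :
    F.dHypCoord Z (Complex.I • W) = Complex.I • F.dHypCoord Z W := by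
  funext a
  simp only [dHypCoord, Matrix.mulVec_smul, Pi.smul_apply, smul_eq_mul]
  ring

theorem dZ_I_smul (p : F.Msk) (ζ : Fin m → ℂ) :
    F.dZ p (Complex.I • ζ) = Complex.I • F.dZ p ζ := by
  unfold dZ
  ext A
  induction A using p.1.idx.succAboveCases with
  | x => simp
  | p a => simp

/-- `dZ` as a continuous linear map. -/
noncomputable def dZCLM (p : F.Msk) : (Fin m → ℂ) →L[ℝ] (Fin (m + 1) → ℂ) :=
  LinearMap.toContinuousLinearMap
    { toFun := F.dZ p
      map_add' := F.dZ_add p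
      map_smul' := F.dZ_smul p }

theorem hasFDerivAt_affVec (p : F.Msk) (z : Fin m → ℂ) :
    HasFDerivAt (CP.affVec p.1.idx) (F.dZCLM p) z := by
  have h : CP.affVec p.1.idx = fun z => F.dZCLM p z + CP.affVec p.1.idx 0 := by
    funext z
    change CP.affVec p.1.idx z = F.dZ p z + _
    unfold dZ CP.affVec
    ext A
    induction A using p.1.idx.succAboveCases with
    | x => simp
    | p a => simp
  rw [h]
  exact (F.dZCLM p).hasFDerivAt.add_const _

theorem QinvC_mulVec_Z_last_ne_zero (p : F.Msk) : (F.QinvC *ᵥ F.Z p) (Fin.last m) ≠ 0 :=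
  F.last_ne_zero_of_pos (F.herm_Z_pos p)

/-- The representative `q.rep` is an arbitrary choice, but `hypCoord` is homogeneous of degree `0`,
so near `p` it may be replaced by the representative with `p.1.idx`-th entry `1`, which varies
smoothly. -/
theorem contMDiffAt_hypCoord_rep (p : F.Msk) :
    ContMDiffAt 𝓘(ℝ, Fin m → ℂ) 𝓘(ℝ, Fin m → ℂ) ∞ (fun q : CP m => F.hypCoord q.rep) p.1 := by
  have h1 : ContMDiffAt 𝓘(ℝ, Fin m → ℂ) 𝓘(ℝ, Fin m → ℂ) ∞
      (fun z => F.hypCoord (CP.affVec p.1.idx z)) (CP.chart p.1.idx p.1) :=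
    (ContDiffAt.comp (CP.coord p.1.idx p.1)
      (F.contDiffAt_hypCoord (F.QinvC_mulVec_Z_last_ne_zero p))
      (CP.contDiff_affVec _).contDiffAt).contMDiffAt
  have h2 : ContMDiffAt 𝓘(ℝ, Fin m → ℂ) 𝓘(ℝ, Fin m → ℂ) ∞ (CP.chart p.1.idx) p.1 :=
    contMDiffAt_of_mem_maximalAtlas (IsManifold.subset_maximalAtlas
      (show CP.chart (m := m) p.1.idx ∈ atlas (Fin m → ℂ) (CP m) from ⟨_, rfl⟩)) p.1.rep_idx_ne_zero
  refine (h1.comp p.1 h2).congr_of_eventuallyEq ?_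
  filter_upwards [(CP.isOpen_source p.1.idx).mem_nhds p.1.rep_idx_ne_zero] with q hq
  change F.hypCoord q.rep = F.hypCoord (CP.affVec p.1.idx (CP.coord p.1.idx q))
  rw [CP.affVec_coord hq, hypCoord_smul F (inv_ne_zero hq)]

theorem hasMFDerivAt_hypCoord_rep (p : F.Msk) :
    HasMFDerivAt 𝓘(ℝ, Fin m → ℂ) 𝓘(ℝ, Fin m → ℂ) (fun q : CP m => F.hypCoord q.rep) p.1
      ((fderiv ℝ F.hypCoord (F.Z p)).comp (F.dZCLM p)) := by
  refine ⟨(F.contMDiffAt_hypCoord_rep p).continuousAt, ?_⟩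
  have h1 := ((F.contDiffAt_hypCoord (F.QinvC_mulVec_Z_last_ne_zero p)).differentiableAt
    (by simp)).hasFDerivAt
  have h2 := h1.comp (CP.coord p.1.idx p.1) (F.hasFDerivAt_affVec p _)
  refine (HasFDerivAt.hasFDerivWithinAt ?_)
  refine h2.congr_of_eventuallyEq (Filter.Eventually.of_forall fun z => ?_)
  exact F.hypCoord_rep_mk ⟨CP.affVec p.1.idx z, CP.affVec_ne_zero _ _⟩

/-- The inhomogeneous coordinates as a diffeomorphism from `M_sk` to complex hyperbolic space. -/
noncomputable def hypDiffeo :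
    F.Msk ≃ₘ⟮𝓘(ℝ, Fin m → ℂ), 𝓘(ℝ, Fin m → ℂ)⟯ complexHyperbolicSpace m where
  toFun p := ⟨F.hypCoord p.1.rep, F.hypCoord_mem p.2⟩
  invFun z := ⟨CP.mk ⟨F.hypVec z, F.hypVec_ne_zero z⟩, F.mk_hypVec_mem z.2⟩
  left_inv p := by
    have h := F.last_ne_zero_of_pos p.2
    refine Subtype.ext ((CP.mk_eq_mk ((F.QinvC *ᵥ p.1.rep) (Fin.last m))⁻¹ ?_).trans p.1.mk_rep)
    simp only [hypVec, affVec_hypCoord F h, Matrix.mulVec_smul, QC_mulVec_QinvC_mulVec]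
  right_inv z := Subtype.ext ((F.hypCoord_rep_mk _).trans (F.hypCoord_hypVec _))
  contMDiff_toFun := by
    rw [← ContMDiff.subtypeVal_comp_iff]
    exact fun p => (contMDiffAt_subtype_iff (I := 𝓘(ℝ, Fin m → ℂ)) (U := F.Msk)
      (f := fun q : CP m => F.hypCoord q.rep)).2 (F.contMDiffAt_hypCoord_rep p)
  contMDiff_invFun := by
    rw [← ContMDiff.subtypeVal_comp_iff]
    have h := CP.contMDiff_mk (f := F.hypVec) ((contDiff_mulVec F.QC).comp
      (CP.contDiff_affVec _)) F.hypVec_ne_zero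
    exact h.comp contMDiff_subtype_val

theorem mfderiv_hypDiffeo (p : F.Msk) (ζ : TangentSpace 𝓘(ℝ, Fin m → ℂ) p) :
    mfderiv 𝓘(ℝ, Fin m → ℂ) 𝓘(ℝ, Fin m → ℂ) F.hypDiffeo p ζ =
      F.dHypCoord (F.Z p) (F.dZ p ζ) := by
  have h := (F.hasMFDerivAt_hypCoord_rep p).comp p (hasMFDerivAt_subtype_val F.Msk p)
  rw [← fderiv_hypCoord F (F.QinvC_mulVec_Z_last_ne_zero p)]
  exact mfderiv_eq_of_subtype_val_comp
    ((F.hypDiffeo.contMDiff p).mdifferentiableAt (by simp)) h ζ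

theorem hypDiffeo_apply (p : F.Msk) : (F.hypDiffeo p : Fin m → ℂ) = F.hypCoord (F.Z p) := by
  change F.hypCoord p.1.rep = _
  rw [Z, CP.affVec_coord p.1.rep_idx_ne_zero, hypCoord_smul F (inv_ne_zero p.1.rep_idx_ne_zero)]

/-- With `W = dZ(ζ)`, write `Q⁻¹W = α Q⁻¹Z + l (ξ, 0)`, where `ξ` is the image of `ζ` in the ball.
The metric on `M_sk` does not see the component of `W` along `Z`, so all terms in `α` cancel and the
hyperbolic expression in `z` and `ξ` is left. -/
theorem hyperbolicMetric_mfderiv_hypDiffeo (p : F.Msk) (ζ : TangentSpace 𝓘(ℝ, Fin m → ℂ) p) :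
    hyperbolicMetric (F.hypDiffeo p)
      (mfderiv 𝓘(ℝ, Fin m → ℂ) 𝓘(ℝ, Fin m → ℂ) F.hypDiffeo p ζ) = F.skMetric p ζ := by
  rw [mfderiv_hypDiffeo]
  simp only [hyperbolicMetric, hypDiffeo_apply, skMetric]
  have hH := F.herm_Z_pos p
  have hl := F.QinvC_mulVec_Z_last_ne_zero p
  generalize F.Z p = Z at hH hl ⊢
  generalize F.dZ p ζ = W
  set l := (F.QinvC *ᵥ Z) (Fin.last m) with hl'
  set z := F.hypCoord Z with hz
  set ξ := F.dHypCoord Z W with hξ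
  -- This is the coefficient for which `Q⁻¹(W - αZ)` has last entry zero.
  set α := (F.QinvC *ᵥ W) (Fin.last m) / l with hα
  have hW0 : (F.QinvC *ᵥ W) (Fin.last m) = α * l := by rw [hα]; field_simp
  have hZa : ∀ a : Fin m, (F.QinvC *ᵥ Z) a.castSucc = l * z a := fun a => by
    change _ = l * (_ / l)
    field_simp
  have hWa : ∀ a : Fin m, (F.QinvC *ᵥ W) a.castSucc = l * (α * z a + ξ a) := fun a => by
    rw [hξ, dHypCoord, ← hl', hW0]; field_simp; ring
  set A := ∑ a, Complex.normSq (ξ a) with hA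
  set B := ∑ a, Complex.normSq (z a) with hB
  set T := ∑ a, ξ a * conj (z a) with hT
  have hA' : ∑ a, ξ a * conj (ξ a) = (A : ℂ) := by simp [hA, Complex.mul_conj]
  have hB' : ∑ a, z a * conj (z a) = (B : ℂ) := by simp [hB, Complex.mul_conj]
  have hT' : ∑ a, z a * conj (ξ a) = conj T := by
    rw [hT, map_sum]
    exact Finset.sum_congr rfl fun a _ => by simp [mul_comm]
  have e1 : (F.herm Z Z).re = Complex.normSq l * (1 - B) := by
    simp only [re_herm_self, hZa, ← hl', map_mul, ← Finset.mul_sum, ← hB]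
    ring
  have e2 : F.herm W Z = Complex.normSq l * (α * (1 - B) - T) := by
    rw [herm_eq, ← hl', hW0]
    have : ∑ a : Fin m, (F.QinvC *ᵥ W) a.castSucc * conj ((F.QinvC *ᵥ Z) a.castSucc) =
        l * conj l * (α * (∑ a, z a * conj (z a)) + T) := by
      rw [hT, Finset.mul_sum, ← Finset.sum_add_distrib, Finset.mul_sum]
      refine Finset.sum_congr rfl fun a _ => ?_
      rw [hZa, hWa, map_mul]; ring
    rw [this, hB', ← Complex.mul_conj]
    ring
  have e3 : F.herm W W = Complex.normSq l *
      (α * conj α * (1 - B) - α * conj T - conj α * T - A) := by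
    rw [herm_eq, hW0]
    have : ∑ a : Fin m, (F.QinvC *ᵥ W) a.castSucc * conj ((F.QinvC *ᵥ W) a.castSucc) =
        l * conj l * (α * conj α * (∑ a, z a * conj (z a)) + α * (∑ a, z a * conj (ξ a)) +
          conj α * T + ∑ a, ξ a * conj (ξ a)) := by
      rw [hT, Finset.mul_sum, Finset.mul_sum, Finset.mul_sum, ← Finset.sum_add_distrib,
        ← Finset.sum_add_distrib, ← Finset.sum_add_distrib, Finset.mul_sum]
      refine Finset.sum_congr rfl fun a _ => ?_
      rw [hWa]; simp only [map_mul, map_add]; ring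
    rw [this, hA', hB', hT', ← Complex.mul_conj, map_mul]
    ring
  -- Positivity of `|l|²` and of `1 - B` is what permits clearing denominators at the end.
  have hn : 0 < Complex.normSq l := Complex.normSq_pos.2 hl
  have hB1 : 0 < 1 - B := by
    rw [e1] at hH
    exact (mul_pos_iff_of_pos_left hn).1 hH
  have e3' : (F.herm W W).re = Complex.normSq l *
      (Complex.normSq α * (1 - B) - 2 * (α.re * T.re + α.im * T.im) - A) := by
    rw [e3, Complex.re_ofReal_mul]
    congr 1
    simp [Complex.normSq_apply]
    ring
  have e2' : Complex.normSq (F.herm W Z) = Complex.normSq l ^ 2 *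
      (Complex.normSq α * (1 - B) ^ 2 - 2 * (1 - B) * (α.re * T.re + α.im * T.im) +
        Complex.normSq T) := by
    rw [e2, Complex.normSq_mul, Complex.normSq_ofReal]
    simp [Complex.normSq_apply]
    ring
  rw [e1, e2', e3']
  field_simp
  ring

end QuadraticPrepotential

/-! ### Holomorphy of the projection and of the product maps. -/

namespace QuadraticPrepotential

variable {m : ℕ} (F : QuadraticPrepotential m)

theorem isHolomorphicMap_fst :
    IsHolomorphicMap (modelM m) 𝓘(ℝ, Fin m → ℂ) F.J3 (mulI 𝓘(ℝ, Fin m → ℂ) F.Msk)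
      (Prod.fst : F.M → F.Msk) := by
  refine ⟨contMDiff_fst, fun p X => ?_⟩
  rw [mfderiv_fst]
  exact F.fst_J3Lin p X

theorem isHolomorphicMap_hypDiffeo :
    IsHolomorphicMap 𝓘(ℝ, Fin m → ℂ) 𝓘(ℝ, Fin m → ℂ) (mulI 𝓘(ℝ, Fin m → ℂ) F.Msk)
      (mulI 𝓘(ℝ, Fin m → ℂ) (complexHyperbolicSpace m)) F.hypDiffeo := by
  refine ⟨F.hypDiffeo.contMDiff, fun p (ζ : Fin m → ℂ) => ?_⟩
  have h : F.dHypCoord (F.Z p) (F.dZ p (Complex.I • ζ)) =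
      Complex.I • F.dHypCoord (F.Z p) (F.dZ p ζ) := by
    rw [dZ_I_smul, dHypCoord_I_smul]
  exact (F.mfderiv_hypDiffeo p _).trans
    (h.trans (congrArg (Complex.I • ·) (F.mfderiv_hypDiffeo p ζ).symm))

/-- The product of a diffeomorphism of `M_sk` with the coordinates `(w^0, w)` of the fibre. -/
noncomputable def prodFibreDiffeo {Y : Type*} [TopologicalSpace Y] [ChartedSpace (Fin m → ℂ) Y]
    (f : F.Msk ≃ₘ⟮𝓘(ℝ, Fin m → ℂ), 𝓘(ℝ, Fin m → ℂ)⟯ Y) :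
    F.M ≃ₘ⟮modelM m, modelProd m⟯ (Y × fibreDomain m) where
  toEquiv := f.toEquiv.prodCongr F.fibreDiffeo.toEquiv
  contMDiff_toFun := f.contMDiff.prodMap F.fibreDiffeo.contMDiff
  contMDiff_invFun := f.symm.contMDiff.prodMap F.fibreDiffeo.symm.contMDiff

/-- The product of a holomorphic diffeomorphism of `M_sk` with the coordinates `(w^0, w)` of the
fibre is holomorphic with respect to `J₃`. -/
theorem isHolomorphicMap_prodFibreDiffeo {Y : Type*} [TopologicalSpace Y]
    [ChartedSpace (Fin m → ℂ) Y] (f : F.Msk ≃ₘ⟮𝓘(ℝ, Fin m → ℂ), 𝓘(ℝ, Fin m → ℂ)⟯ Y)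
    (hf : IsHolomorphicMap 𝓘(ℝ, Fin m → ℂ) 𝓘(ℝ, Fin m → ℂ) (mulI 𝓘(ℝ, Fin m → ℂ) F.Msk)
      (mulI 𝓘(ℝ, Fin m → ℂ) Y) f) :
    IsHolomorphicMap (modelM m) (modelProd m) F.J3 (mulI (modelProd m) (Y × fibreDomain m))
      (F.prodFibreDiffeo f) := by
  refine ⟨(F.prodFibreDiffeo f).contMDiff, fun p X => ?_⟩
  have h1 := ((f.contMDiff p.1).mdifferentiableAt (by simp)).hasMFDerivAt
  have h2 := ((F.fibreDiffeo.contMDiff p.2).mdifferentiableAt (by simp)).hasMFDerivAt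
  -- The differential is block diagonal, so `J₃`-linearity can be checked separately for base and
  -- fibre.
  have h : ∀ X : TangentSpace (modelM m) p,
      mfderiv (modelM m) (modelProd m) (F.prodFibreDiffeo f) p X =
      ((mfderiv 𝓘(ℝ, Fin m → ℂ) 𝓘(ℝ, Fin m → ℂ) f p.1 X.1 : Fin m → ℂ),
        (F.dw0 p.2 X.2, F.wCoord X.2)) := fun X => by
    have h3 : mfderiv (modelM m) (modelProd m) (F.prodFibreDiffeo f) p = _ :=
      (h1.prodMap h2).mfderiv
    rw [h3]
    exact Prod.ext rfl (F.mfderiv_fibreDiffeo p.2 X.2)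
  rw [h, h]
  refine Prod.ext ?_ (Prod.ext (F.dw0_J3Lin p X) (F.wCoord_J3Lin p X))
  have h3 := hf.2 p.1 X.1
  exact (congrArg (mfderiv 𝓘(ℝ, Fin m → ℂ) 𝓘(ℝ, Fin m → ℂ) f p.1) (F.fst_J3Lin p X)).trans h3

theorem isHolomorphicMap_refl {E H X : Type*} [NormedAddCommGroup E] [NormedSpace ℝ E]
    [TopologicalSpace H] [TopologicalSpace X] [ChartedSpace H X] (I : ModelWithCorners ℝ E H)
    (J : TangentEndField I X) : IsHolomorphicMap I I J J (Diffeomorph.refl I X ∞) := by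
  refine ⟨contMDiff_id, fun x v => ?_⟩
  change mfderiv I I id x (J x v) = J x (mfderiv I I id x v)
  rw [mfderiv_id]
  rfl

end QuadraticPrepotential

theorem mainTheorem9 (m : ℕ) (F : QuadraticPrepotential m) :
    -- `π : (M, J₃) → M_sk` is a holomorphic submersion
    (IsHolomorphicMap (QuadraticPrepotential.modelM m) 𝓘(ℝ, Fin m → ℂ)
        F.J3 (mulI 𝓘(ℝ, Fin m → ℂ) F.Msk) (Prod.fst : F.M → F.Msk) ∧
      ∀ p : F.M, Function.Surjective
        (mfderiv (QuadraticPrepotential.modelM m) 𝓘(ℝ, Fin m → ℂ) (Prod.fst : F.M → F.Msk) p)) ∧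
    -- `M_sk` is the complex hyperbolic space `H_ℂ^(n-1)`, as a Kähler manifold
    (∃ ψ : F.Msk ≃ₘ⟮𝓘(ℝ, Fin m → ℂ), 𝓘(ℝ, Fin m → ℂ)⟯ complexHyperbolicSpace m,
      IsHolomorphicMap 𝓘(ℝ, Fin m → ℂ) 𝓘(ℝ, Fin m → ℂ)
        (mulI 𝓘(ℝ, Fin m → ℂ) F.Msk) (mulI 𝓘(ℝ, Fin m → ℂ) (complexHyperbolicSpace m)) ψ ∧
      ∀ (p : F.Msk) (ζ : TangentSpace 𝓘(ℝ, Fin m → ℂ) p),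
        hyperbolicMetric (ψ p) (mfderiv 𝓘(ℝ, Fin m → ℂ) 𝓘(ℝ, Fin m → ℂ) ψ p ζ) =
          F.skMetric p ζ) ∧
    -- `π` is a trivial holomorphic fibre bundle with fibre `F(n+1)`
    (∃ Ψ : F.M ≃ₘ⟮QuadraticPrepotential.modelM m, modelProd m⟯ (F.Msk × fibreDomain m),
      IsHolomorphicMap (QuadraticPrepotential.modelM m) (modelProd m)
        F.J3 (mulI (modelProd m) (F.Msk × fibreDomain m)) Ψ ∧
      ∀ p : F.M, (Ψ p).1 = p.1) ∧
    -- `(M, J₃)` is biholomorphic to `H_ℂ^(n-1) × F(n+1)`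
    (∃ Φ : F.M ≃ₘ⟮QuadraticPrepotential.modelM m, modelProd m⟯
        (complexHyperbolicSpace m × fibreDomain m),
      IsHolomorphicMap (QuadraticPrepotential.modelM m) (modelProd m)
        F.J3 (mulI (modelProd m) (complexHyperbolicSpace m × fibreDomain m)) Φ) := by
  refine ⟨⟨F.isHolomorphicMap_fst, fun p => ?_⟩,
    ⟨F.hypDiffeo, F.isHolomorphicMap_hypDiffeo, F.hyperbolicMetric_mfderiv_hypDiffeo⟩,
    -- Taking the identity on the base makes the trivialisation commute with the projections by
    -- definition.
    ⟨F.prodFibreDiffeo (Diffeomorph.refl _ F.Msk ∞),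
      F.isHolomorphicMap_prodFibreDiffeo _ (QuadraticPrepotential.isHolomorphicMap_refl _ _),
      fun _ => rfl⟩,
    ⟨F.prodFibreDiffeo F.hypDiffeo,
      F.isHolomorphicMap_prodFibreDiffeo _ F.isHolomorphicMap_hypDiffeo⟩⟩
  rw [mfderiv_fst]
  exact fun v => ⟨(v, 0), rfl⟩
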